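/- Let $n\ge 1$ and $\beta\in(-\infty,0)\cup(0,1/n)$. Let $\mathcal P_n$ be the set of real symmetric positive-definite $n\times n$ matrices, and let $\mathcal M_n^\beta$ be $\mathcal P_n$ with the Riemannian metric \[ g_X^\beta(H,K)=(\det X)^\beta\bigl(\operatorname{tr}(X^{-1}HX^{-1}K)-\beta\operatorname{tr}(X^{-1}H)\operatorname{tr}(X^{-1}K)\bigr) \] for $X\in\mathcal P_n$ and $H,K$ symmetric. For $A,B\in\mathcal P_n$, let $\mathscr C_{A,B}$ be the set of $C^2$ curves $P:[0,1]\to\mathcal P_n$ with $P(0)=A$, $P(1)=B$. A geodesic of $\mathcal M_n^\beta$ joining $A$ and $B$ is a curve $P\in\mathscr C_{A,B}$ of constant speed $\sqrt{g^\beta_{P(t)}(P'(t),P'(t))}$ that minimizes the length $\int_0^1\sqrt{g^\beta_{P(t)}(P'(t),P'(t))}\,dt$ over $\mathscr C_{A,B}$. For a matrix $C=M^{-1}\operatorname{diag}(d_1,\dots,d_n)M$ with $M$ invertible and all $d_i>0$, put $C^q=M^{-1}\operatorname{diag}(d_1^q,\dots,d_n^q)M$. For $M,N\in\mathcal P_n$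 let $\delta(M,N)=\bigl(\sum_{i}\ln^2\lambda_i\bigr)^{1/2}$, where $\lambda_1,\dots,\lambda_n$ are the eigenvalues of $M^{-1}N$, and let \[ \gamma:=\gamma_\beta(A,B)=\frac{|\beta|\,\delta\bigl(\det(A)^{-1/n}A,\det(B)^{-1/n}B\bigr)}{2\sqrt{1/n-\beta}},\qquad \sigma:=\det(A^{-1}B)^{\beta/2}. \] If $A,B\in\mathcal P_n$ and $\gamma<\pi/2$, then there is a unique geodesic $G$ of $\mathcal M_n^\beta$ joining $A$ and $B$. Moreover, every curve in $\mathscr C_{A,B}$ of minimal length is of the form $t\mapsto G(s(t))$ with $s:[0,1]\to[0,1]$ continuous, nondecreasing, $s(0)=0$ and $s(1)=1$. Explicitly, for all $t\in[0,1]$: if $\gamma\neq0$, then \[ G(t)=\eta(t)\,A(A^{-1}B)^{\alpha(t)},\qquad \alpha(t)=\frac1\gamma\arctan\Bigl(\frac{t\sigma\sin\gamma}{1-t+t\sigma\cos\gamma}\Bigr),\qquad \eta(t)=\Bigl(\frac{(1-t)^2+2t(1-t)\sigma\cos\gamma+t^2\sigma^2}{\sigma^{2\alpha(t)}}\Bigr)^{\frac1{n\beta}},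 \] and if $\gamma=0$, then \[ G(t)=\bigl((1-t)A^{\frac{n\beta}2}+tB^{\frac{n\beta}2}\bigr)^{\frac2{n\beta}}. \] -/

import Mathlib

namespace PowerPotential

noncomputable section

variable {n : ℕ}

/-- The square real matrix `C` is diagonalizable over the reals with positive eigenvalues
`d 0, …, d (n - 1)`, diagonalized by the invertible matrix `M`: `C = M⁻¹ diag(d) M`. -/
def IsPosDiagonalization (C M : Matrix (Fin n) (Fin n) ℝ) (d : Fin n → ℝ) : Prop :=
  IsUnit M.det ∧ (∀ i, 0 < d i) ∧ C = M⁻¹ * Matrix.diagonal d * M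

open Classical in
/-- The primary matrix power: `C ^ q = M⁻¹ diag(d_i ^ q) M` whenever `C = M⁻¹ diag(d) M` with `M`
invertible and all `d_i` positive (independent of the choice of `M` and `d`, see `matPow_eq`);
the value for matrices that have no such diagonalization is irrelevant. -/
def matPow (C : Matrix (Fin n) (Fin n) ℝ) (q : ℝ) : Matrix (Fin n) (Fin n) ℝ :=
  if h : ∃ p : Matrix (Fin n) (Fin n) ℝ × (Fin n → ℝ), IsPosDiagonalization C p.1 p.2 then
    h.choose.1⁻¹ * Matrix.diagonal (fun i => h.choose.2 i ^ q) * h.choose.1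
  else 0

/-- The primary matrix power does not depend on the diagonalization. -/
theorem matPow_eq {C M : Matrix (Fin n) (Fin n) ℝ} {d : Fin n → ℝ}
    (h : IsPosDiagonalization C M d) (q : ℝ) :
    matPow C q = M⁻¹ * Matrix.diagonal (fun i => d i ^ q) * M := by
  have hex : ∃ p : Matrix (Fin n) (Fin n) ℝ × (Fin n → ℝ), IsPosDiagonalization C p.1 p.2 :=
    ⟨(M, d), h⟩
  rw [matPow, dif_pos hex]
  obtain ⟨hN, -, hCN⟩ := hex.choose_spec
  set N := hex.choose.1
  set e := hex.choose.2
  obtain ⟨hM, -, hCM⟩ := h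
  have key : (N * M⁻¹) * Matrix.diagonal d = Matrix.diagonal e * (N * M⁻¹) := by
    have h1 : N * C * M⁻¹ = (N * M⁻¹) * Matrix.diagonal d := by
      rw [hCM]; simp only [Matrix.mul_assoc, Matrix.mul_nonsing_inv M hM, Matrix.mul_one]
    have h2 : N * C * M⁻¹ = Matrix.diagonal e * (N * M⁻¹) := by
      rw [hCN]
      simp only [← Matrix.mul_assoc, Matrix.mul_nonsing_inv N hN, Matrix.one_mul]
    rw [← h1, h2]
  have key' : (N * M⁻¹) * Matrix.diagonal (fun i => d i ^ q)
      = Matrix.diagonal (fun i => e i ^ q) * (N * M⁻¹) := by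
    ext i j
    have hij := congrFun (congrFun key i) j
    rw [Matrix.mul_diagonal, Matrix.diagonal_mul] at hij ⊢
    by_cases h0 : (N * M⁻¹) i j = 0
    · simp [h0]
    · have : d j = e i := by
        apply mul_left_cancel₀ h0
        rw [hij, mul_comm]
      rw [this, mul_comm]
  calc N⁻¹ * Matrix.diagonal (fun i => e i ^ q) * N
      = N⁻¹ * (Matrix.diagonal (fun i => e i ^ q) * (N * M⁻¹)) * M := by
        simp only [Matrix.mul_assoc, Matrix.nonsing_inv_mul M hM, Matrix.mul_one]
    _ = M⁻¹ * Matrix.diagonal (fun i => d i ^ q) * M := by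
        rw [← key']
        simp only [← Matrix.mul_assoc, Matrix.nonsing_inv_mul N hN, Matrix.one_mul]

/-- The Riemannian metric of `M_n^β` at the positive-definite matrix `X`: for symmetric `H`, `K`,
`g_X(H, K) = det(X)^β (tr(X⁻¹ H X⁻¹ K) - β tr(X⁻¹ H) tr(X⁻¹ K))`. -/
def metric (β : ℝ) (X H K : Matrix (Fin n) (Fin n) ℝ) : ℝ :=
  X.det ^ β * ((X⁻¹ * H * X⁻¹ * K).trace - β * (X⁻¹ * H).trace * (X⁻¹ * K).trace)

/-- The velocity `P'(t)` of a curve of matrices on `[0, 1]`, entry by entry (one-sided derivatives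
at the end points). -/
def velocity (P : ℝ → Matrix (Fin n) (Fin n) ℝ) (t : ℝ) : Matrix (Fin n) (Fin n) ℝ :=
  Matrix.of fun i j => derivWithin (fun s => P s i j) (Set.Icc 0 1) t

/-- The speed `√(g_{P(t)}(P'(t), P'(t)))` of a curve in `M_n^β`. -/
def speed (β : ℝ) (P : ℝ → Matrix (Fin n) (Fin n) ℝ) (t : ℝ) : ℝ :=
  √(metric β (P t) (velocity P t) (velocity P t))

/-- The length of a curve `[0, 1] → M_n^β`. -/
def curveLength (β : ℝ) (P : ℝ → Matrix (Fin n) (Fin n) ℝ) : ℝ :=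
  ∫ t in (0 : ℝ)..1, speed β P t

/-- The `C²` curves `[0, 1] → P_n` from `A` to `B` (values outside `[0, 1]` play no role). -/
def curvesJoining (A B : Matrix (Fin n) (Fin n) ℝ) : Set (ℝ → Matrix (Fin n) (Fin n) ℝ) :=
  {P | (∀ t ∈ Set.Icc (0 : ℝ) 1, (P t).PosDef) ∧
    (∀ i j, ContDiffOn ℝ 2 (fun t => P t i j) (Set.Icc 0 1)) ∧ P 0 = A ∧ P 1 = B}

/-- `P` is a curve of minimal length in `M_n^β` among the `C²` curves from `A` to `B`. -/
def IsLengthMinimizing (β : ℝ) (A B : Matrix (Fin n) (Fin n) ℝ)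
    (P : ℝ → Matrix (Fin n) (Fin n) ℝ) : Prop :=
  P ∈ curvesJoining A B ∧ ∀ Q ∈ curvesJoining A B, curveLength β P ≤ curveLength β Q

/-- `P` is a geodesic joining `A` and `B` in `M_n^β`: a length-minimizing `C²` curve, parametrized
proportionally to arc length. -/
def IsGeodesic (β : ℝ) (A B : Matrix (Fin n) (Fin n) ℝ)
    (P : ℝ → Matrix (Fin n) (Fin n) ℝ) : Prop :=
  IsLengthMinimizing β A B P ∧ ∃ v : ℝ, ∀ t ∈ Set.Icc (0 : ℝ) 1, speed β P t = v

/-- `δ(M, N) = (∑ ln² λ_i)^{1/2}`, with `λ_i` the eigenvalues of `M⁻¹ N`, repeated according to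
multiplicity. -/
def traceDist (M N : Matrix (Fin n) (Fin n) ℝ) : ℝ :=
  √(((M⁻¹ * N).charpoly.roots.map fun x => Real.log x ^ 2).sum)

/-- `γ_β(A, B) = |β| δ(det(A)^{-1/n} A, det(B)^{-1/n} B) / (2 √(1/n - β))`. -/
def gammaDist (β : ℝ) (A B : Matrix (Fin n) (Fin n) ℝ) : ℝ :=
  |β| * traceDist (A.det ^ (-(1 / (n : ℝ))) • A) (B.det ^ (-(1 / (n : ℝ))) • B) /
    (2 * √(1 / (n : ℝ) - β))

/-- `σ = det(A⁻¹ B)^{β/2}`. -/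
def sigmaRatio (β : ℝ) (A B : Matrix (Fin n) (Fin n) ℝ) : ℝ :=
  (A⁻¹ * B).det ^ (β / 2)

/-- `α(t) = (1/γ) arctan(t σ sin γ / (1 - t + t σ cos γ))`. -/
def alphaFun (β : ℝ) (A B : Matrix (Fin n) (Fin n) ℝ) (t : ℝ) : ℝ :=
  1 / gammaDist β A B *
    Real.arctan (t * sigmaRatio β A B * Real.sin (gammaDist β A B) /
      (1 - t + t * sigmaRatio β A B * Real.cos (gammaDist β A B)))

/-- `η(t) = (((1-t)² + 2 t (1-t) σ cos γ + t² σ²) / σ^{2 α(t)})^{1/(nβ)}`. -/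
def etaFun (β : ℝ) (A B : Matrix (Fin n) (Fin n) ℝ) (t : ℝ) : ℝ :=
  (((1 - t) ^ 2 + 2 * t * (1 - t) * sigmaRatio β A B * Real.cos (gammaDist β A B)
      + t ^ 2 * sigmaRatio β A B ^ 2) / sigmaRatio β A B ^ (2 * alphaFun β A B t))
    ^ (1 / ((n : ℝ) * β))

/-- The weighted geometric mean `A #_s B = A (A⁻¹ B)^s`. -/
def geoMean (A B : Matrix (Fin n) (Fin n) ℝ) (s : ℝ) : Matrix (Fin n) (Fin n) ℝ :=
  A * matPow (A⁻¹ * B) s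

/-- The weighted power mean `((1 - t) A^p + t B^p)^{1/p}`. -/
def powerMean (p : ℝ) (A B : Matrix (Fin n) (Fin n) ℝ) (t : ℝ) : Matrix (Fin n) (Fin n) ℝ :=
  matPow ((1 - t) • matPow A p + t • matPow B p) (1 / p)

end

end PowerPotential

/-!
The proof compares `M_n^β` with a plane. For a symmetric velocity `H` at `X`, the metric splits into
the square of the derivative of `det(X)^{β/2}`, up to a constant, and `det(X)^β` times the squared
norm of the trace-free part of `X⁻¹ H`. So `M_n^β` is a cone with radial coordinate `det(X)^{β/2}`
over the symmetric space of unimodular matrices.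

After a congruence, which multiplies all lengths by the same constant, the end points are `1` and
`diag d` (`exists_simultaneous_diagonalization`, `speed_congruence`). The symmetric space is
projected to its flat of diagonal matrices by the Iwasawa decomposition, that is, by the pivots of
the Gram-Schmidt orthogonalization of the standard basis (`gsMatrix`, `pivot`). In the
Gram-Schmidt frame the diagonal of the velocity carries the derivatives of the logarithms of the
pivots (`pivot_hasDerivWithinAt`), so the projection does not increase length. The flat is Euclidean
and is projected further to the line through the end point. The cone over that line is a plane with
polar coordinates `coneRadius`, `coneAngle`; the squared speed of a curve is the squared speed of
its image in the plane, up to a constant factor, plus a sum of squares, the excess (`metric_eq_cone`,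
`speed_sq`).

Hence a curve is at least as long as the straight segment between the images of its end points,
which are seen from the origin under the angle `γ < π / 2`. If equality holds, its image runs
monotonically through the segment and the excess vanishes identically. Vanishing of the off-diagonal
part of the excess makes the Gram-Schmidt frame stationary (`gsMatrix_stationary`), so the curve is
diagonal; vanishing of the remaining part confines it to the sector over the line. There a matrix is
determined by its planar point (`eq_sectorPoint`), and the curve is a monotone reparametrization of
the lift of the segment (`length_lower_bound_and_rigidity`). Conversely the lift `sectorCurve` has no
excess, hence constant speed and minimal length (`sectorCurve_speed`). Polar coordinates on the
segment give the formulas with `arctan`.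
-/

namespace PowerPotential

open Matrix

/-! ### Gram-Schmidt frames -/

/-- The Gram-Schmidt orthogonalization of the standard basis with respect to the bilinear form of
`X`, without normalization: `gsVec X k` lies in `e_k + span (e_i, i < k)`. -/
noncomputable def gsVec {n : ℕ} (X : Matrix (Fin n) (Fin n) ℝ) (k : Fin n) : Fin n → ℝ :=
  Pi.single k 1 - ∑ i : Finset.Iio k,
    ((gsVec X i ⬝ᵥ X *ᵥ Pi.single k 1) / (gsVec X i ⬝ᵥ X *ᵥ gsVec X i)) • gsVec X i
termination_by k
decreasing_by all_goals exact Fin.lt_def.1 (Finset.mem_Iio.1 i.2)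

/-- The unit upper triangular matrix whose columns are the vectors `gsVec X k`. -/
noncomputable def gsMatrix {n : ℕ} (X : Matrix (Fin n) (Fin n) ℝ) : Matrix (Fin n) (Fin n) ℝ :=
  Matrix.of fun i k => gsVec X k i

section GramSchmidt

variable {n : ℕ} {X : Matrix (Fin n) (Fin n) ℝ}

theorem gsVec_eq (X : Matrix (Fin n) (Fin n) ℝ) (k : Fin n) :
    gsVec X k = Pi.single k 1 - ∑ i ∈ Finset.Iio k,
      ((gsVec X i ⬝ᵥ X *ᵥ Pi.single k 1) / (gsVec X i ⬝ᵥ X *ᵥ gsVec X i)) • gsVec X i := by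
  rw [gsVec, ← Finset.sum_attach (Finset.Iio k)]
  rfl

theorem gsVec_apply_of_lt (X : Matrix (Fin n) (Fin n) ℝ) {k i : Fin n} (h : k < i) :
    gsVec X k i = 0 := by
  induction k using WellFoundedLT.induction with
  | ind k ih =>
    rw [gsVec_eq, Pi.sub_apply, Pi.single_eq_of_ne h.ne', Finset.sum_apply, zero_sub, neg_eq_zero]
    refine Finset.sum_eq_zero fun j hj => ?_
    have hj := Finset.mem_Iio.1 hj
    rw [Pi.smul_apply, ih j hj (hj.trans h), smul_zero]

theorem gsVec_apply_self (X : Matrix (Fin n) (Fin n) ℝ) (k : Fin n) : gsVec X k k = 1 := by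
  rw [gsVec_eq, Pi.sub_apply, Pi.single_eq_same, Finset.sum_apply, Finset.sum_eq_zero, sub_zero]
  intro j hj
  rw [Pi.smul_apply, gsVec_apply_of_lt X (Finset.mem_Iio.1 hj), smul_zero]

theorem gsVec_form_pos (hX : X.PosDef) (k : Fin n) : 0 < gsVec X k ⬝ᵥ X *ᵥ gsVec X k := by
  have h0 : gsVec X k ≠ 0 := fun h => by
    have := gsVec_apply_self X k
    rw [h] at this
    simp at this
  simpa using hX.dotProduct_mulVec_pos h0

theorem dotProduct_mulVec_comm_of_posDef (hX : X.PosDef) (v w : Fin n → ℝ) :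
    v ⬝ᵥ X *ᵥ w = w ⬝ᵥ X *ᵥ v := by
  have hs : Xᵀ = X := by simpa using hX.isHermitian.eq
  rw [dotProduct_mulVec, ← mulVec_transpose, hs, dotProduct_comm]

theorem gsVec_orthogonal (hX : X.PosDef) {k l : Fin n} (h : l < k) :
    gsVec X k ⬝ᵥ X *ᵥ gsVec X l = 0 := by
  induction k using WellFoundedLT.induction generalizing l with
  | ind k ih =>
    rw [gsVec_eq X k, sub_dotProduct, sum_dotProduct, Finset.sum_eq_single_of_mem l
      (Finset.mem_Iio.2 h), smul_dotProduct, smul_eq_mul,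
      div_mul_cancel₀ _ (gsVec_form_pos hX l).ne',
      dotProduct_mulVec_comm_of_posDef hX (gsVec X l), sub_self]
    intro j hj hjl
    rw [smul_dotProduct]
    rcases lt_or_gt_of_ne hjl with h1 | h1
    · rw [dotProduct_mulVec_comm_of_posDef hX (gsVec X j) (gsVec X l), ih l h h1, smul_zero]
    · rw [ih j (Finset.mem_Iio.1 hj) h1, smul_zero]

theorem gsVec_orthogonal_single (hX : X.PosDef) {k i : Fin n} (h : i < k) :
    gsVec X k ⬝ᵥ X *ᵥ Pi.single i 1 = 0 := by
  have h1 : (Pi.single i 1 : Fin n → ℝ) = gsVec X i + ∑ j ∈ Finset.Iio i,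
      ((gsVec X j ⬝ᵥ X *ᵥ Pi.single i 1) / (gsVec X j ⬝ᵥ X *ᵥ gsVec X j)) • gsVec X j := by
    rw [gsVec_eq X i, sub_add_cancel]
  rw [h1, mulVec_add, dotProduct_add, gsVec_orthogonal hX h, mulVec_sum, dotProduct_sum,
    Finset.sum_eq_zero, add_zero]
  intro j hj
  rw [mulVec_smul, dotProduct_smul, gsVec_orthogonal hX ((Finset.mem_Iio.1 hj).trans h), smul_zero]

theorem gsVec_diagonal (d : Fin n → ℝ) (k : Fin n) :
    gsVec (diagonal d) k = Pi.single k 1 := by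
  induction k using WellFoundedLT.induction with
  | ind k ih =>
    rw [gsVec_eq, Finset.sum_eq_zero, sub_zero]
    intro j hj
    have hj := Finset.mem_Iio.1 hj
    rw [ih j hj]
    simp [hj.ne]

theorem gsMatrix_diagonal (d : Fin n → ℝ) : gsMatrix (diagonal d) = 1 := by
  ext i k
  simp [gsMatrix, gsVec_diagonal, Matrix.one_apply, Pi.single_apply]

theorem det_gsMatrix (X : Matrix (Fin n) (Fin n) ℝ) : (gsMatrix X).det = 1 := by
  rw [det_of_isUpperTriangular]
  · simp [gsMatrix, gsVec_apply_self]
  · intro i j h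
    exact gsVec_apply_of_lt X h

/-- The pivots of `X`: the squared `X`-norms of the Gram-Schmidt vectors. -/
noncomputable def pivot (X : Matrix (Fin n) (Fin n) ℝ) (k : Fin n) : ℝ :=
  gsVec X k ⬝ᵥ X *ᵥ gsVec X k

theorem gsMatrix_conj_apply (X H : Matrix (Fin n) (Fin n) ℝ) (k l : Fin n) :
    ((gsMatrix X)ᵀ * H * gsMatrix X) k l = gsVec X k ⬝ᵥ H *ᵥ gsVec X l := by
  rw [Matrix.mul_assoc, Matrix.mul_apply]
  rfl

theorem gsMatrix_conj (hX : X.PosDef) :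
    (gsMatrix X)ᵀ * X * gsMatrix X = diagonal (pivot X) := by
  ext k l
  rw [gsMatrix_conj_apply, diagonal_apply]
  split_ifs with h
  · subst h; rfl
  · rcases lt_or_gt_of_ne h with h | h
    · rw [dotProduct_mulVec_comm_of_posDef hX, gsVec_orthogonal hX h]
    · exact gsVec_orthogonal hX h

theorem det_eq_prod_pivot (hX : X.PosDef) : X.det = ∏ k, pivot X k := by
  have h := congrArg Matrix.det (gsMatrix_conj hX)
  simpa [det_gsMatrix] using h

theorem pivot_diagonal (d : Fin n → ℝ) : pivot (diagonal d) = d := by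
  ext k
  simp [pivot, gsVec_diagonal]

end GramSchmidt

/-! ### The metric in a frame -/

section Frame

variable {n : ℕ} {X V : Matrix (Fin n) (Fin n) ℝ} {D : Fin n → ℝ}

theorem inv_eq_of_frame (hV : IsUnit V.det) (hD : ∀ i, 0 < D i)
    (h : Vᵀ * X * V = diagonal D) : X⁻¹ = V * diagonal (fun i => (D i)⁻¹) * Vᵀ := by
  have hVt : IsUnit Vᵀ.det := by rwa [det_transpose]
  have hX : X = Vᵀ⁻¹ * diagonal D * V⁻¹ := by
    rw [← h, Matrix.mul_assoc Vᵀ, nonsing_inv_mul_cancel_left _ _ hVt,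
      mul_nonsing_inv_cancel_right _ _ hV]
  have hDD : diagonal D * diagonal (fun i => (D i)⁻¹) = 1 := by
    rw [diagonal_mul_diagonal, ← diagonal_one]
    congr 1
    ext i
    exact mul_inv_cancel₀ (hD i).ne'
  refine inv_eq_right_inv ?_
  rw [hX]
  simp only [Matrix.mul_assoc]
  rw [nonsing_inv_mul_cancel_left _ _ hV, ← Matrix.mul_assoc (diagonal D), hDD, Matrix.one_mul,
    nonsing_inv_mul _ hVt]

/-- The metric read in an `X`-orthogonal frame. -/
theorem metric_of_frame (β : ℝ) (hV : IsUnit V.det) (hD : ∀ i, 0 < D i)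
    (h : Vᵀ * X * V = diagonal D) (H : Matrix (Fin n) (Fin n) ℝ) :
    metric β X H H = X.det ^ β *
      (∑ k, ∑ l, (Vᵀ * H * V) k l * (Vᵀ * H * V) l k / (D k * D l)
        - β * (∑ k, (Vᵀ * H * V) k k / D k) ^ 2) := by
  set N := Vᵀ * H * V with hN
  have hXi := inv_eq_of_frame hV hD h
  set E := diagonal (fun i => (D i)⁻¹) with hE
  have h1 : (X⁻¹ * H).trace = ∑ k, N k k / D k := by
    have : (X⁻¹ * H).trace = (E * N).trace := by
      rw [hXi, hN, Matrix.mul_assoc V, Matrix.mul_assoc V, trace_mul_comm V]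
      simp only [Matrix.mul_assoc]
    rw [this, Matrix.trace]
    refine Finset.sum_congr rfl fun k _ => ?_
    rw [Matrix.diag_apply, diagonal_mul, div_eq_inv_mul]
  have h2 : (X⁻¹ * H * X⁻¹ * H).trace = ∑ k, ∑ l, N k l * N l k / (D k * D l) := by
    have : (X⁻¹ * H * X⁻¹ * H).trace = ((E * N) * (E * N)).trace := by
      rw [hXi, hN]
      simp only [Matrix.mul_assoc]
      rw [trace_mul_comm V]
      simp only [Matrix.mul_assoc]
    rw [this, Matrix.trace]
    refine Finset.sum_congr rfl fun k _ => ?_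
    rw [Matrix.diag_apply, Matrix.mul_apply]
    refine Finset.sum_congr rfl fun l _ => ?_
    rw [diagonal_mul, diagonal_mul, div_eq_mul_inv, mul_inv]
    ring
  rw [metric, h1, h2]
  ring

end Frame

/-! ### Differentiable curves of matrices -/

/-- Entrywise differentiability of a curve of matrices within `[0, 1]`, with derivative `H`. -/
def EntryDeriv {n : ℕ} (P : ℝ → Matrix (Fin n) (Fin n) ℝ) (H : Matrix (Fin n) (Fin n) ℝ)
    (t : ℝ) : Prop :=
  ∀ i j, HasDerivWithinAt (fun s => P s i j) (H i j) (Set.Icc 0 1) t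

section Curves

variable {n : ℕ} {P Q : ℝ → Matrix (Fin n) (Fin n) ℝ} {H K : Matrix (Fin n) (Fin n) ℝ} {t : ℝ}

theorem EntryDeriv.mul (hP : EntryDeriv P H t) (hQ : EntryDeriv Q K t) :
    EntryDeriv (fun s => P s * Q s) (H * Q t + P t * K) t := by
  intro i j
  simp only [Matrix.mul_apply, Matrix.add_apply, ← Finset.sum_add_distrib]
  exact HasDerivWithinAt.fun_sum fun k _ => (hP i k).mul (hQ k j)

theorem EntryDeriv.transpose (hP : EntryDeriv P H t) : EntryDeriv (fun s => (P s)ᵀ) Hᵀ t :=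
  fun i j => hP j i

theorem EntryDeriv.const (A : Matrix (Fin n) (Fin n) ℝ) (t : ℝ) :
    EntryDeriv (fun _ => A) 0 t := fun _ _ => hasDerivWithinAt_const _ _ _

theorem gsVec_differentiableWithinAt (hP : ∀ i j, DifferentiableWithinAt ℝ
      (fun s => P s i j) (Set.Icc 0 1) t) (hpos : (P t).PosDef) (k i : Fin n) :
    DifferentiableWithinAt ℝ (fun s => gsVec (P s) k i) (Set.Icc 0 1) t := by
  induction k using WellFoundedLT.induction generalizing i with
  | ind k ih =>
    have key : ∀ j ∈ Finset.Iio k, DifferentiableWithinAt ℝ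
        (fun s => (gsVec (P s) j ⬝ᵥ P s *ᵥ Pi.single k 1) /
          (gsVec (P s) j ⬝ᵥ P s *ᵥ gsVec (P s) j) * gsVec (P s) j i) (Set.Icc 0 1) t := by
      intro j hj
      have ihj := ih j (Finset.mem_Iio.1 hj)
      refine DifferentiableWithinAt.mul (DifferentiableWithinAt.div ?_ ?_
        (gsVec_form_pos hpos j).ne') (ihj i)
      · simp only [dotProduct, mulVec]
        exact DifferentiableWithinAt.fun_sum fun a _ => (ihj a).mul
          (DifferentiableWithinAt.fun_sum fun b _ => (hP a b).mul
            (differentiableWithinAt_const _))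
      · simp only [dotProduct, mulVec]
        exact DifferentiableWithinAt.fun_sum fun a _ => (ihj a).mul
          (DifferentiableWithinAt.fun_sum fun b _ => (hP a b).mul (ihj b))
    have heq : (fun s => gsVec (P s) k i) = fun s => (Pi.single k 1 : Fin n → ℝ) i -
        ∑ j ∈ Finset.Iio k, (gsVec (P s) j ⬝ᵥ P s *ᵥ Pi.single k 1) /
          (gsVec (P s) j ⬝ᵥ P s *ᵥ gsVec (P s) j) * gsVec (P s) j i := by
      ext s
      conv_lhs => rw [gsVec_eq]
      simp [Finset.sum_apply]
    rw [heq]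
    exact (differentiableWithinAt_const _).sub (DifferentiableWithinAt.fun_sum key)

theorem uniqueDiff_unitInterval (ht : t ∈ Set.Icc (0 : ℝ) 1) :
    UniqueDiffWithinAt ℝ (Set.Icc (0 : ℝ) 1) t := uniqueDiffOn_Icc zero_lt_one t ht

/-- The derivative of the Gram-Schmidt frame `V` of a curve `P`: the matrix `V' = dV/dt` is strictly
upper triangular, and so is `T = Vᵀ P V'`, because the columns of `V` are orthogonalized from the
left. Differentiating `Vᵀ P V = diag (pivot)` thus gives `diag (pivot)' = Tᵀ + Vᵀ P' V + T`, which
determines both the derivatives of the pivots and `V'`. -/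
theorem exists_frame_deriv (hpos : ∀ s ∈ Set.Icc (0 : ℝ) 1, (P s).PosDef)
    (ht : t ∈ Set.Icc (0 : ℝ) 1) (hP : EntryDeriv P H t) :
    ∃ V' T : Matrix (Fin n) (Fin n) ℝ, EntryDeriv (fun s => gsMatrix (P s)) V' t ∧
      T = (gsMatrix (P t))ᵀ * P t * V' ∧ (∀ k l, l ≤ k → T k l = 0) ∧
      EntryDeriv (fun s => diagonal (pivot (P s)))
        (Tᵀ + (gsMatrix (P t))ᵀ * H * gsMatrix (P t) + T) t := by
  set V' : Matrix (Fin n) (Fin n) ℝ :=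
    Matrix.of fun i j => derivWithin (fun s => gsMatrix (P s) i j) (Set.Icc 0 1) t with hV'
  have hV : EntryDeriv (fun s => gsMatrix (P s)) V' t := fun i j =>
    (gsVec_differentiableWithinAt (fun i j => (hP i j).differentiableWithinAt)
      (hpos t ht) j i).hasDerivWithinAt
  have hlow : ∀ i j, j ≤ i → V' i j = 0 := by
    intro i j hij
    have hc : (fun s => gsMatrix (P s) i j) = fun _ => if j = i then (1 : ℝ) else 0 := by
      ext s
      rcases hij.lt_or_eq with h | h
      · rw [if_neg h.ne]; exact gsVec_apply_of_lt _ h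
      · rw [if_pos h, h]; exact gsVec_apply_self _ _
    rw [hV', Matrix.of_apply, hc, derivWithin_fun_const]
    rfl
  have hVP : ∀ k i, i < k → ((gsMatrix (P t))ᵀ * P t) k i = 0 := by
    intro k i hik
    have h := gsVec_orthogonal_single (hpos t ht) hik
    rw [mulVec_single_one] at h
    rw [Matrix.mul_apply]
    exact h
  refine ⟨V', _, hV, rfl, ?_, ?_⟩
  · intro k l hlk
    rw [Matrix.mul_apply]
    refine Finset.sum_eq_zero fun i _ => ?_
    rcases lt_or_ge i k with h | h
    · rw [hVP k i h, zero_mul]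
    · rw [hlow i l (hlk.trans h), mul_zero]
  · have hd := (hV.transpose.mul hP).mul hV
    have hs : (P t)ᵀ = P t := by simpa using (hpos t ht).isHermitian.eq
    intro i j
    refine HasDerivWithinAt.congr_deriv ((hd i j).congr (fun s hs => ?_) ?_) ?_
    · exact (congrFun (congrFun (gsMatrix_conj (hpos s hs)) i) j).symm
    · exact (congrFun (congrFun (gsMatrix_conj (hpos t ht)) i) j).symm
    · rw [transpose_mul, transpose_mul, transpose_transpose, hs]
      simp only [Matrix.mul_assoc, Matrix.add_mul]

theorem pivot_hasDerivWithinAt (hpos : ∀ s ∈ Set.Icc (0 : ℝ) 1, (P s).PosDef)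
    (ht : t ∈ Set.Icc (0 : ℝ) 1) (hP : EntryDeriv P H t) (k : Fin n) :
    HasDerivWithinAt (fun s => pivot (P s) k)
      (((gsMatrix (P t))ᵀ * H * gsMatrix (P t)) k k) (Set.Icc 0 1) t := by
  obtain ⟨V', T, -, -, hT, hd⟩ := exists_frame_deriv hpos ht hP
  have h := hd k k
  simpa [hT k k le_rfl] using h

/-- Where the velocity is diagonal in the Gram-Schmidt frame, the frame is stationary. -/
theorem gsMatrix_stationary (hpos : ∀ s ∈ Set.Icc (0 : ℝ) 1, (P s).PosDef)
    (ht : t ∈ Set.Icc (0 : ℝ) 1) (hP : EntryDeriv P H t)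
    (hoff : ∀ k l, k ≠ l → ((gsMatrix (P t))ᵀ * H * gsMatrix (P t)) k l = 0) :
    EntryDeriv (fun s => gsMatrix (P s)) 0 t := by
  obtain ⟨V', T, hV, hTdef, hT, hd⟩ := exists_frame_deriv hpos ht hP
  have hu := uniqueDiff_unitInterval ht
  have hT0 : T = 0 := by
    ext k l
    rcases le_or_gt l k with h | h
    · exact hT k l h
    · have h1 := hd k l
      have h2 : (fun s => diagonal (pivot (P s)) k l) = fun _ => (0 : ℝ) := by
        ext s; exact diagonal_apply_ne _ h.ne
      rw [h2] at h1
      have h3 := hu.eq_deriv _ h1 (hasDerivWithinAt_const _ _ _)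
      simpa [hT l k h.le, hoff k l h.ne] using h3
  have hunit : IsUnit ((gsMatrix (P t))ᵀ * P t).det := by
    rw [det_mul, det_transpose, det_gsMatrix, one_mul]
    exact (hpos t ht).det_pos.ne'.isUnit
  have hV0 : V' = 0 := by
    rw [← nonsing_inv_mul_cancel_left _ V' hunit, ← hTdef, hT0, Matrix.mul_zero]
  rwa [hV0] at hV

end Curves

/-! ### Cone coordinates -/

/-- The factor `2 √(1/n - β) / |β|` by which the length in the plane of the cone coordinates has to
be multiplied to give the length in `M_n^β`. -/
noncomputable def coneScale (n : ℕ) (β : ℝ) : ℝ := 2 * √(1 / (n : ℝ) - β) / |β|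

/-- The radial cone coordinate `det(X)^{β/2}`, expressed through the pivots of `X`. -/
noncomputable def coneRadius {n : ℕ} (β : ℝ) (X : Matrix (Fin n) (Fin n) ℝ) : ℝ :=
  Real.exp (β / 2 * ∑ k, Real.log (pivot X k))

/-- The angular cone coordinate of `X` in the direction `u`. -/
noncomputable def coneAngle {n : ℕ} (β : ℝ) (u : Fin n → ℝ) (X : Matrix (Fin n) (Fin n) ℝ) : ℝ :=
  (∑ k, u k * Real.log (pivot X k)) / coneScale n β

/-- A direction in the diagonal flat: a trace-free vector which is either a unit vector or zero,
the latter being needed where there is no distinguished direction. -/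
structure IsDirection {n : ℕ} (u : Fin n → ℝ) : Prop where
  sum_eq_zero : ∑ k, u k = 0
  unit_or_zero : ∑ k, u k ^ 2 = 1 ∨ u = 0

section Cone

variable {n : ℕ} {β : ℝ} {u : Fin n → ℝ}

theorem coneScale_pos (hβ0 : β ≠ 0) (hβ : β < 1 / n) : 0 < coneScale n β := by
  have : 0 < 1 / (n : ℝ) - β := by linarith
  have := abs_pos.2 hβ0
  unfold coneScale
  positivity

theorem coneScale_sq (hβ0 : β ≠ 0) (hβ : β < 1 / n) :
    coneScale n β ^ 2 * (β / 2) ^ 2 = 1 / n - β := by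
  rw [coneScale, div_pow, mul_pow, Real.sq_sqrt (by linarith), sq_abs]
  field_simp

theorem IsDirection.sum_sq (hn : 1 ≤ n) (hu : IsDirection u) (β : ℝ) (h : Fin n → ℝ) :
    ∑ k, h k ^ 2 - β * (∑ k, h k) ^ 2 = (1 / n - β) * (∑ k, h k) ^ 2 + (∑ k, u k * h k) ^ 2 +
      ∑ k, (h k - (∑ j, h j) / n - (∑ j, u j * h j) * u k) ^ 2 := by
  have hn0 : (n : ℝ) ≠ 0 := by positivity
  set S := ∑ k, h k with hS
  set p := ∑ k, u k * h k with hp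
  have hpu : p ^ 2 * ∑ k, u k ^ 2 = p ^ 2 := by
    rcases hu.unit_or_zero with h1 | h1
    · rw [h1, mul_one]
    · simp [hp, h1]
  have e : ∀ k, (h k - S / n - p * u k) ^ 2 =
      h k ^ 2 + S ^ 2 / n ^ 2 + p ^ 2 * u k ^ 2 - 2 * (S / n) * h k - 2 * p * (u k * h k)
        + 2 * (S / n) * p * u k := fun k => by ring
  simp only [e, Finset.sum_add_distrib, Finset.sum_sub_distrib, ← Finset.mul_sum, ← hS, ← hp,
    hu.sum_eq_zero, hpu, Finset.sum_const, Finset.card_univ, Fintype.card_fin, nsmul_eq_mul]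
  field_simp
  ring

theorem coneRadius_pos (X : Matrix (Fin n) (Fin n) ℝ) : 0 < coneRadius β X := Real.exp_pos _

theorem det_rpow_eq_coneRadius_sq {X : Matrix (Fin n) (Fin n) ℝ} (hX : X.PosDef) :
    X.det ^ β = coneRadius β X ^ 2 := by
  have hD : ∀ k, 0 < pivot X k := gsVec_form_pos hX
  rw [det_eq_prod_pivot hX, coneRadius, ← Real.exp_nat_mul,
    Real.rpow_def_of_pos (Finset.prod_pos fun k _ => hD k),
    Real.log_prod fun k _ => (hD k).ne']
  congr 1
  push_cast
  ring

/-- The metric in cone coordinates. The first summand is `coneScale² (r'² + r² θ'²)`, the rescaled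
Euclidean metric in polar coordinates; the second is a sum of squares which vanishes if and only if
the velocity is diagonal in the frame, with entries in the span of `1` and `u`. -/
theorem metric_eq_cone (hn : 1 ≤ n) (hβ0 : β ≠ 0) (hβ : β < 1 / n) (hu : IsDirection u)
    {X H : Matrix (Fin n) (Fin n) ℝ} (hX : X.PosDef) (hH : Hᵀ = H) {N : Matrix (Fin n) (Fin n) ℝ}
    (hN : N = (gsMatrix X)ᵀ * H * gsMatrix X) {h : Fin n → ℝ}
    (hh : ∀ k, h k = N k k / pivot X k) :
    metric β X H H = coneScale n β ^ 2 * ((coneRadius β X * (β / 2 * ∑ k, h k)) ^ 2 +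
        (coneRadius β X * ((∑ k, u k * h k) / coneScale n β)) ^ 2) +
      coneRadius β X ^ 2 * (∑ k, ∑ l, (if k = l then 0 else N k l ^ 2 / (pivot X k * pivot X l)) +
        ∑ k, (h k - (∑ j, h j) / n - (∑ j, u j * h j) * u k) ^ 2) := by
  have hD : ∀ k, 0 < pivot X k := gsVec_form_pos hX
  have hNs : ∀ k l, N l k = N k l := by
    intro k l
    have : Nᵀ = N := by
      rw [hN, transpose_mul, transpose_mul, hH, transpose_transpose, Matrix.mul_assoc]
    exact congrFun (congrFun this k) l
  have hsplit : ∑ k, ∑ l, N k l * N l k / (pivot X k * pivot X l) = ∑ k, h k ^ 2 +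
      ∑ k, ∑ l, (if k = l then 0 else N k l ^ 2 / (pivot X k * pivot X l)) := by
    rw [← Finset.sum_add_distrib]
    refine Finset.sum_congr rfl fun k _ => ?_
    have h1 : h k ^ 2 = ∑ l, if k = l then h k ^ 2 else 0 := by simp
    rw [h1, ← Finset.sum_add_distrib]
    refine Finset.sum_congr rfl fun l _ => ?_
    by_cases hkl : k = l
    · subst hkl
      rw [if_pos rfl, if_pos rfl, hh, div_pow]
      ring
    · rw [if_neg hkl, if_neg hkl, hNs]
      ring
  rw [metric_of_frame β (by rw [det_gsMatrix]; exact isUnit_one) hD (gsMatrix_conj hX) H, ← hN,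
    hsplit, det_rpow_eq_coneRadius_sq hX]
  simp only [← hh]
  have hc := (coneScale_pos hβ0 hβ).ne'
  have h1 := hu.sum_sq hn β h
  have h2 := coneScale_sq hβ0 hβ
  have h3 : coneScale n β ^ 2 * (coneRadius β X * ((∑ k, u k * h k) / coneScale n β)) ^ 2 =
      coneRadius β X ^ 2 * (∑ k, u k * h k) ^ 2 := by field_simp
  rw [mul_add (coneScale n β ^ 2), h3]
  linear_combination coneRadius β X ^ 2 * h1 -
    coneRadius β X ^ 2 * (∑ k, h k) ^ 2 * h2

end Cone

/-! ### The calibration inequality -/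

section Plane

/-- The planar velocity `(x', y')` of a curve, the speed `v`, and a unit or zero vector `w`:
`c ⟨w, z'⟩ ≤ v`, with equality only if `z'` is a multiple of `w` and the excess `E` vanishes. -/
theorem planar_calibration {c r x y v w₁ w₂ E : ℝ} (hc : 0 < c) (hr : 0 < r) (hE : 0 ≤ E)
    (hv : 0 ≤ v) (hw : w₁ ^ 2 + w₂ ^ 2 = 1 ∨ w₁ = 0 ∧ w₂ = 0)
    (hsq : v ^ 2 = c ^ 2 * (x ^ 2 + y ^ 2) + r ^ 2 * E) :
    c * (w₁ * x + w₂ * y) ≤ v ∧ (c * (w₁ * x + w₂ * y) = v →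
      x = (w₁ * x + w₂ * y) * w₁ ∧ y = (w₁ * x + w₂ * y) * w₂ ∧ E = 0) := by
  set p := w₁ * x + w₂ * y with hp
  have hpw : p ^ 2 * (w₁ ^ 2 + w₂ ^ 2) = p ^ 2 := by
    rcases hw with h | ⟨h, h'⟩
    · rw [h, mul_one]
    · simp [hp, h, h']
  have hdist : (x - p * w₁) ^ 2 + (y - p * w₂) ^ 2 = x ^ 2 + y ^ 2 - p ^ 2 := by
    linear_combination hpw + 2 * p * hp
  have hple : 0 ≤ x ^ 2 + y ^ 2 - p ^ 2 := by rw [← hdist]; positivity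
  have hrE : 0 ≤ r ^ 2 * E := by positivity
  have hcp : 0 ≤ c ^ 2 * (x ^ 2 + y ^ 2 - p ^ 2) := by positivity
  refine ⟨abs_le_of_sq_le_sq' (by nlinarith) hv |>.2, fun heq => ?_⟩
  rw [← heq] at hsq
  have h0 : c ^ 2 * (x ^ 2 + y ^ 2 - p ^ 2) = 0 := by nlinarith
  have hE0 : r ^ 2 * E = 0 := by nlinarith
  have h1 : x ^ 2 + y ^ 2 - p ^ 2 = 0 := (mul_eq_zero.1 h0).resolve_left (by positivity)
  rw [h1] at hdist
  have hx := sq_nonneg (x - p * w₁)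
  have hy := sq_nonneg (y - p * w₂)
  refine ⟨?_, ?_, (mul_eq_zero.1 hE0).resolve_left (by positivity)⟩
  · exact sub_eq_zero.1 (pow_eq_zero_iff two_ne_zero |>.1 (by linarith))
  · exact sub_eq_zero.1 (pow_eq_zero_iff two_ne_zero |>.1 (by linarith))

/-- If `F' ≤ v` on `[0, 1]` then `F 1 - F 0 ≤ ∫ v`; equality forces `F' = v`, and then `F` is the
primitive of `v`. -/
theorem integral_calibration {F F' v : ℝ → ℝ} (hv : ContinuousOn v (Set.Icc 0 1))
    (hF : ∀ t ∈ Set.Icc (0 : ℝ) 1, HasDerivWithinAt F (F' t) (Set.Icc 0 1) t)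
    (hle : ∀ t ∈ Set.Icc (0 : ℝ) 1, F' t ≤ v t) :
    F 1 - F 0 ≤ ∫ t in (0 : ℝ)..1, v t ∧ (F 1 - F 0 = ∫ t in (0 : ℝ)..1, v t →
      ∀ t ∈ Set.Icc (0 : ℝ) 1, F' t = v t ∧ F t - F 0 = ∫ s in (0 : ℝ)..t, v s) := by
  set V : ℝ → ℝ := Set.IccExtend zero_le_one ((Set.Icc (0 : ℝ) 1).domRestrict v) with hV
  have hVc : Continuous V := (continuousOn_iff_continuous_domRestrict.1 hv).Icc_extend'
  have hVv : ∀ t ∈ Set.Icc (0 : ℝ) 1, V t = v t := fun t ht => Set.IccExtend_of_mem _ _ ht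
  have hint : ∀ t ∈ Set.Icc (0 : ℝ) 1, ∫ s in (0 : ℝ)..t, V s = ∫ s in (0 : ℝ)..t, v s := by
    intro t ht
    refine intervalIntegral.integral_congr fun s hs => ?_
    rw [Set.uIcc_of_le ht.1] at hs
    exact hVv s ⟨hs.1, hs.2.trans ht.2⟩
  set S : ℝ → ℝ := fun t => (∫ s in (0 : ℝ)..t, V s) - F t with hS
  have hSd : ∀ t ∈ Set.Icc (0 : ℝ) 1, HasDerivWithinAt S (v t - F' t) (Set.Icc 0 1) t := by
    intro t ht
    rw [← hVv t ht]
    exact (hVc.integral_hasStrictDerivAt 0 t).hasDerivAt.hasDerivWithinAt.sub (hF t ht)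
  have hmono : MonotoneOn S (Set.Icc 0 1) := by
    refine monotoneOn_of_deriv_nonneg (convex_Icc 0 1)
      (fun t ht => (hSd t ht).continuousWithinAt) ?_ ?_ <;> rw [interior_Icc] <;> intro t ht
    · exact ((hSd t (Set.Ioo_subset_Icc_self ht)).hasDerivAt
        (Icc_mem_nhds ht.1 ht.2)).differentiableAt.differentiableWithinAt
    · have ht' := Set.Ioo_subset_Icc_self ht
      rw [((hSd t ht').hasDerivAt (Icc_mem_nhds ht.1 ht.2)).deriv]
      linarith [hle t ht']
  have h0 : (0 : ℝ) ∈ Set.Icc (0 : ℝ) 1 := ⟨le_rfl, zero_le_one⟩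
  have h1 : (1 : ℝ) ∈ Set.Icc (0 : ℝ) 1 := ⟨zero_le_one, le_rfl⟩
  have hS0 : S 0 = -F 0 := by simp [hS]
  have hS1 : S 1 = (∫ t in (0 : ℝ)..1, v t) - F 1 := by simp only [hS, hint 1 h1]
  have hm := hmono h0 h1 zero_le_one
  refine ⟨by linarith, fun heq t ht => ?_⟩
  have hconst : ∀ s ∈ Set.Icc (0 : ℝ) 1, S s = -F 0 := fun s hs => by
    have := hmono h0 hs hs.1
    have := hmono hs h1 hs.2
    linarith
  constructor
  · have hd : HasDerivWithinAt S 0 (Set.Icc 0 1) t :=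
      (hasDerivWithinAt_const t _ (-F 0)).congr hconst (hconst t ht)
    have := (uniqueDiff_unitInterval ht).eq_deriv _ (hSd t ht) hd
    linarith
  · have := hconst t ht
    simp only [hS, hint t ht] at this
    linarith

/-- A function with vanishing derivative on `[0, 1]` is constant. -/
theorem eq_of_hasDerivWithinAt_zero {f : ℝ → ℝ}
    (hf : ∀ t ∈ Set.Icc (0 : ℝ) 1, HasDerivWithinAt f 0 (Set.Icc 0 1) t) {t : ℝ}
    (ht : t ∈ Set.Icc (0 : ℝ) 1) : f t = f 0 :=
  constant_of_derivWithin_zero (fun s hs => (hf s hs).differentiableWithinAt)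
    (fun s hs => (hf s (Set.Ico_subset_Icc_self hs)).derivWithin
      (uniqueDiff_unitInterval (Set.Ico_subset_Icc_self hs))) t ht

end Plane

/-! ### Curves in cone coordinates -/

/-- The velocity of `Q` in the Gram-Schmidt frame. -/
noncomputable def frameVel {n : ℕ} (Q : ℝ → Matrix (Fin n) (Fin n) ℝ) (t : ℝ) :
    Matrix (Fin n) (Fin n) ℝ :=
  (gsMatrix (Q t))ᵀ * velocity Q t * gsMatrix (Q t)

/-- The derivatives of the logarithms of the pivots along `Q`. -/
noncomputable def logVel {n : ℕ} (Q : ℝ → Matrix (Fin n) (Fin n) ℝ) (t : ℝ) (k : Fin n) : ℝ :=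
  frameVel Q t k k / pivot (Q t) k

/-- The first Cartesian coordinate in the plane with polar coordinates `coneRadius`,
`coneAngle`. -/
noncomputable def coneX {n : ℕ} (β : ℝ) (u : Fin n → ℝ) (X : Matrix (Fin n) (Fin n) ℝ) : ℝ :=
  coneRadius β X * Real.cos (coneAngle β u X)

/-- The second Cartesian coordinate in the plane with polar coordinates `coneRadius`,
`coneAngle`. -/
noncomputable def coneY {n : ℕ} (β : ℝ) (u : Fin n → ℝ) (X : Matrix (Fin n) (Fin n) ℝ) : ℝ :=
  coneRadius β X * Real.sin (coneAngle β u X)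

/-- The derivative of `coneRadius` along `Q`. -/
noncomputable def radiusVel {n : ℕ} (β : ℝ) (Q : ℝ → Matrix (Fin n) (Fin n) ℝ) (t : ℝ) : ℝ :=
  coneRadius β (Q t) * (β / 2 * ∑ k, logVel Q t k)

/-- The derivative of `coneAngle` along `Q`. -/
noncomputable def angleVel {n : ℕ} (β : ℝ) (u : Fin n → ℝ) (Q : ℝ → Matrix (Fin n) (Fin n) ℝ)
    (t : ℝ) : ℝ := (∑ k, u k * logVel Q t k) / coneScale n β

/-- The part of the squared speed that is lost under the projection to the plane of the cone
coordinates, divided by `coneRadius²`. -/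
noncomputable def coneExcess {n : ℕ} (u : Fin n → ℝ) (Q : ℝ → Matrix (Fin n) (Fin n) ℝ) (t : ℝ) :
    ℝ :=
  ∑ k, ∑ l, (if k = l then 0 else frameVel Q t k l ^ 2 / (pivot (Q t) k * pivot (Q t) l)) +
    ∑ k, (logVel Q t k - (∑ j, logVel Q t j) / n - (∑ j, u j * logVel Q t j) * u k) ^ 2

section CurveCone

variable {n : ℕ} {β : ℝ} {u : Fin n → ℝ} {A B : Matrix (Fin n) (Fin n) ℝ}
  {Q : ℝ → Matrix (Fin n) (Fin n) ℝ} {t : ℝ}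

theorem entryDeriv_velocity (hQ : Q ∈ curvesJoining A B) (ht : t ∈ Set.Icc (0 : ℝ) 1) :
    EntryDeriv Q (velocity Q t) t := fun i j =>
  ((hQ.2.1 i j).differentiableOn (by norm_num) t ht).hasDerivWithinAt

theorem EntryDeriv.eq_velocity {H : Matrix (Fin n) (Fin n) ℝ} (h : EntryDeriv Q H t)
    (ht : t ∈ Set.Icc (0 : ℝ) 1) : velocity Q t = H := by
  ext i j
  exact (h i j).derivWithin (uniqueDiff_unitInterval ht)

theorem velocity_transpose (hQ : Q ∈ curvesJoining A B) (ht : t ∈ Set.Icc (0 : ℝ) 1) :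
    (velocity Q t)ᵀ = velocity Q t := by
  ext i j
  have hs : ∀ s ∈ Set.Icc (0 : ℝ) 1, Q s j i = Q s i j := fun s hs => by
    have h : (Q s)ᵀ = Q s := by simpa using (hQ.1 s hs).isHermitian.eq
    exact congrFun (congrFun h i) j
  exact derivWithin_congr hs (hs t ht)

theorem pivot_pos {X : Matrix (Fin n) (Fin n) ℝ} (hX : X.PosDef) (k : Fin n) : 0 < pivot X k :=
  gsVec_form_pos hX k

theorem logVel_spec (hQ : Q ∈ curvesJoining A B) (ht : t ∈ Set.Icc (0 : ℝ) 1) (k : Fin n) :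
    HasDerivWithinAt (fun s => Real.log (pivot (Q s) k)) (logVel Q t k) (Set.Icc 0 1) t :=
  (pivot_hasDerivWithinAt hQ.1 ht (entryDeriv_velocity hQ ht) k).log (pivot_pos (hQ.1 t ht) k).ne'

theorem coneRadius_hasDerivWithinAt (hQ : Q ∈ curvesJoining A B) (ht : t ∈ Set.Icc (0 : ℝ) 1) :
    HasDerivWithinAt (fun s => coneRadius β (Q s)) (radiusVel β Q t) (Set.Icc 0 1) t :=
  ((HasDerivWithinAt.fun_sum fun k _ => logVel_spec hQ ht k).const_mul (β / 2)).exp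

theorem coneAngle_hasDerivWithinAt (hQ : Q ∈ curvesJoining A B) (ht : t ∈ Set.Icc (0 : ℝ) 1) :
    HasDerivWithinAt (fun s => coneAngle β u (Q s)) (angleVel β u Q t) (Set.Icc 0 1) t :=
  (HasDerivWithinAt.fun_sum fun k _ => (logVel_spec hQ ht k).const_mul (u k)).div_const _

theorem coneX_hasDerivWithinAt (hQ : Q ∈ curvesJoining A B) (ht : t ∈ Set.Icc (0 : ℝ) 1) :
    HasDerivWithinAt (fun s => coneX β u (Q s))
      (radiusVel β Q t * Real.cos (coneAngle β u (Q t)) +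
        coneRadius β (Q t) * (-Real.sin (coneAngle β u (Q t)) * angleVel β u Q t))
      (Set.Icc 0 1) t :=
  (coneRadius_hasDerivWithinAt hQ ht).mul (coneAngle_hasDerivWithinAt hQ ht).cos

theorem coneY_hasDerivWithinAt (hQ : Q ∈ curvesJoining A B) (ht : t ∈ Set.Icc (0 : ℝ) 1) :
    HasDerivWithinAt (fun s => coneY β u (Q s))
      (radiusVel β Q t * Real.sin (coneAngle β u (Q t)) +
        coneRadius β (Q t) * (Real.cos (coneAngle β u (Q t)) * angleVel β u Q t))
      (Set.Icc 0 1) t :=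
  (coneRadius_hasDerivWithinAt hQ ht).mul (coneAngle_hasDerivWithinAt hQ ht).sin

theorem coneExcess_nonneg (hQ : Q ∈ curvesJoining A B) (ht : t ∈ Set.Icc (0 : ℝ) 1) :
    0 ≤ coneExcess u Q t := by
  have hD := pivot_pos (hQ.1 t ht)
  refine add_nonneg (Finset.sum_nonneg fun k _ => Finset.sum_nonneg fun l _ => ?_)
    (Finset.sum_nonneg fun k _ => sq_nonneg _)
  have := hD k
  have := hD l
  split_ifs <;> positivity

theorem coneExcess_eq_zero (hQ : Q ∈ curvesJoining A B) (ht : t ∈ Set.Icc (0 : ℝ) 1)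
    (h : coneExcess u Q t = 0) : (∀ k l, k ≠ l → frameVel Q t k l = 0) ∧
      ∀ k, logVel Q t k = (∑ j, logVel Q t j) / n + (∑ j, u j * logVel Q t j) * u k := by
  have hD := pivot_pos (hQ.1 t ht)
  have hnn : ∀ k l, 0 ≤ if k = l then 0 else
      frameVel Q t k l ^ 2 / (pivot (Q t) k * pivot (Q t) l) := fun k l => by
    have := hD k
    have := hD l
    split_ifs <;> positivity
  rw [coneExcess, add_eq_zero_iff_of_nonneg
    (Finset.sum_nonneg fun k _ => Finset.sum_nonneg fun l _ => hnn k l)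
    (Finset.sum_nonneg fun k _ => sq_nonneg _)] at h
  obtain ⟨h1, h2⟩ := h
  constructor
  · intro k l hkl
    rw [Finset.sum_eq_zero_iff_of_nonneg fun k _ => Finset.sum_nonneg fun l _ => hnn k l] at h1
    have h3 := h1 k (Finset.mem_univ k)
    rw [Finset.sum_eq_zero_iff_of_nonneg fun l _ => hnn k l] at h3
    have h4 := h3 l (Finset.mem_univ l)
    rw [if_neg hkl, div_eq_zero_iff] at h4
    exact pow_eq_zero_iff two_ne_zero |>.1 (h4.resolve_right (mul_pos (hD k) (hD l)).ne')
  · intro k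
    rw [Finset.sum_eq_zero_iff_of_nonneg fun k _ => sq_nonneg _] at h2
    have := pow_eq_zero_iff two_ne_zero |>.1 (h2 k (Finset.mem_univ k))
    linarith

/-- The squared speed of a curve is the squared speed of its projection to the plane, rescaled,
plus the excess. -/
theorem speed_sq (hn : 1 ≤ n) (hβ0 : β ≠ 0) (hβ : β < 1 / n) (hu : IsDirection u)
    (hQ : Q ∈ curvesJoining A B) (ht : t ∈ Set.Icc (0 : ℝ) 1) {x' y' : ℝ}
    (hx : HasDerivWithinAt (fun s => coneX β u (Q s)) x' (Set.Icc 0 1) t)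
    (hy : HasDerivWithinAt (fun s => coneY β u (Q s)) y' (Set.Icc 0 1) t) :
    speed β Q t ^ 2 = coneScale n β ^ 2 * (x' ^ 2 + y' ^ 2) +
      coneRadius β (Q t) ^ 2 * coneExcess u Q t := by
  have hud := uniqueDiff_unitInterval ht
  have hm := metric_eq_cone (β := β) hn hβ0 hβ hu (hQ.1 t ht) (velocity_transpose hQ ht)
    (N := frameVel Q t) rfl (h := logVel Q t) fun _ => rfl
  change _ = coneScale n β ^ 2 * (radiusVel β Q t ^ 2 + (coneRadius β (Q t) * angleVel β u Q t) ^ 2)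
    + coneRadius β (Q t) ^ 2 * coneExcess u Q t at hm
  have hE := coneExcess_nonneg (u := u) hQ ht
  rw [speed, Real.sq_sqrt (by rw [hm]; positivity), hm,
    hud.eq_deriv _ hx (coneX_hasDerivWithinAt hQ ht),
    hud.eq_deriv _ hy (coneY_hasDerivWithinAt hQ ht)]
  have hcs := Real.sin_sq_add_cos_sq (coneAngle β u (Q t))
  linear_combination -coneScale n β ^ 2 *
    (radiusVel β Q t ^ 2 + (coneRadius β (Q t) * angleVel β u Q t) ^ 2) * hcs

theorem continuousOn_speed (hQ : Q ∈ curvesJoining A B) :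
    ContinuousOn (speed β Q) (Set.Icc 0 1) := by
  have hc : ContinuousOn Q (Set.Icc 0 1) :=
    continuousOn_pi.2 fun i => continuousOn_pi.2 fun j => (hQ.2.1 i j).continuousOn
  have hv : ContinuousOn (velocity Q) (Set.Icc 0 1) :=
    continuousOn_pi.2 fun i => continuousOn_pi.2 fun j =>
      (hQ.2.1 i j).continuousOn_derivWithin (uniqueDiffOn_Icc zero_lt_one) (by norm_num)
  have hdet : ContinuousOn (fun s => (Q s).det) (Set.Icc 0 1) :=
    (Continuous.matrix_det continuous_id).comp_continuousOn hc
  have hdet0 : ∀ s ∈ Set.Icc (0 : ℝ) 1, (Q s).det ≠ 0 := fun s hs => (hQ.1 s hs).det_pos.ne'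
  have hinv : ContinuousOn (fun s => (Q s)⁻¹) (Set.Icc 0 1) := by
    simp only [Matrix.inv_def, Ring.inverse_eq_inv']
    exact (hdet.inv₀ hdet0).smul ((Continuous.matrix_adjugate continuous_id).comp_continuousOn hc)
  have htr : Continuous (Matrix.trace : Matrix (Fin n) (Fin n) ℝ → ℝ) :=
    Continuous.matrix_trace continuous_id
  have h1 := hinv.mul hv
  refine ContinuousOn.sqrt ((hdet.rpow_const fun s hs => Or.inl (hdet0 s hs)).mul
    ((htr.comp_continuousOn ((h1.mul hinv).mul hv)).sub
      ((continuousOn_const.mul (htr.comp_continuousOn h1)).mul (htr.comp_continuousOn h1))))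

theorem speed_nonneg : 0 ≤ speed β Q t := Real.sqrt_nonneg _

end CurveCone

/-! ### Minimal curves issuing from the identity -/

/-- The diagonal entries of the diagonal matrix over the point `(x, y)` of the plane, in the sector
of the flat spanned by the identity and the direction `u`. -/
noncomputable def sectorPoint {n : ℕ} (β : ℝ) (u : Fin n → ℝ) (x y : ℝ) (k : Fin n) : ℝ :=
  Real.exp (1 / (n * β) * Real.log (x ^ 2 + y ^ 2) + coneScale n β * Real.arctan (y / x) * u k)

/-- The curve of diagonal matrices over the straight segment from `(1, 0)` to `(x, y)`. -/
noncomputable def sectorCurve {n : ℕ} (β : ℝ) (u : Fin n → ℝ) (x y : ℝ) (s : ℝ) :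
    Matrix (Fin n) (Fin n) ℝ :=
  diagonal (sectorPoint β u (1 - s + s * x) (s * y))

section Normalized

variable {n : ℕ} {β : ℝ} {u d : Fin n → ℝ} {Q : ℝ → Matrix (Fin n) (Fin n) ℝ} {t : ℝ}

theorem pivot_one : pivot (1 : Matrix (Fin n) (Fin n) ℝ) = fun _ => 1 := by
  rw [← diagonal_one, pivot_diagonal]

theorem gsMatrix_one : gsMatrix (1 : Matrix (Fin n) (Fin n) ℝ) = 1 := by
  conv_lhs => rw [← diagonal_one]
  exact gsMatrix_diagonal _

theorem coneX_one : coneX β u 1 = 1 := by simp [coneX, coneRadius, coneAngle, pivot_one]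

theorem coneY_one : coneY β u 1 = 0 := by simp [coneY, coneRadius, coneAngle, pivot_one]

theorem coneX_sq_add_coneY_sq (X : Matrix (Fin n) (Fin n) ℝ) :
    coneX β u X ^ 2 + coneY β u X ^ 2 = coneRadius β X ^ 2 := by
  rw [coneX, coneY]
  linear_combination coneRadius β X ^ 2 * Real.sin_sq_add_cos_sq (coneAngle β u X)

/-- A continuous angle starting at `0` whose cosine stays positive stays in `(-π/2, π/2)`. -/
theorem abs_lt_pi_div_two_of_cos_pos {θ : ℝ → ℝ} (hθ : ContinuousOn θ (Set.Icc 0 1))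
    (h0 : θ 0 = 0) (hcos : ∀ t ∈ Set.Icc (0 : ℝ) 1, 0 < Real.cos (θ t))
    (ht : t ∈ Set.Icc (0 : ℝ) 1) : |θ t| < Real.pi / 2 := by
  by_contra! hge
  have hsub : Set.Icc 0 t ⊆ Set.Icc (0 : ℝ) 1 := Set.Icc_subset_Icc_right ht.2
  have hmem : Real.pi / 2 ∈ Set.Icc |θ 0| |θ t| := ⟨by rw [h0, abs_zero]; positivity, hge⟩
  obtain ⟨s, hs, hs'⟩ := intermediate_value_Icc ht.1 (hθ.mono hsub).abs hmem
  have := hcos s (hsub hs)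
  rw [← Real.cos_abs] at this
  simp only [] at hs'
  rw [hs', Real.cos_pi_div_two] at this
  exact lt_irrefl _ this

theorem monotoneOn_of_hasDerivWithinAt_nonneg {F F' : ℝ → ℝ}
    (hF : ∀ t ∈ Set.Icc (0 : ℝ) 1, HasDerivWithinAt F (F' t) (Set.Icc 0 1) t)
    (hF' : ∀ t ∈ Set.Icc (0 : ℝ) 1, 0 ≤ F' t) : MonotoneOn F (Set.Icc 0 1) := by
  refine monotoneOn_of_deriv_nonneg (convex_Icc 0 1)
    (fun t ht => (hF t ht).continuousWithinAt) ?_ ?_ <;> rw [interior_Icc] <;> intro t ht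
  · exact ((hF t (Set.Ioo_subset_Icc_self ht)).hasDerivAt
      (Icc_mem_nhds ht.1 ht.2)).differentiableAt.differentiableWithinAt
  · have ht' := Set.Ioo_subset_Icc_self ht
    rw [((hF t ht').hasDerivAt (Icc_mem_nhds ht.1 ht.2)).deriv]
    exact hF' t ht'

/-- A diagonal matrix of the sector spanned by `1` and `u` is determined by its planar point. -/
theorem eq_sectorPoint {a : Fin n → ℝ} (hβ0 : β ≠ 0) (hβ : β < 1 / n)
    (ha : ∀ k, 0 < a k)
    (hsec : ∀ k, Real.log (a k) =
      (∑ j, Real.log (a j)) / n + (∑ j, u j * Real.log (a j)) * u k)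
    (hθ : |coneAngle β u (diagonal a)| < Real.pi / 2) :
    a = sectorPoint β u (coneX β u (diagonal a)) (coneY β u (diagonal a)) := by
  have hc := (coneScale_pos hβ0 hβ).ne'
  obtain ⟨h1, h2⟩ := abs_lt.1 hθ
  ext k
  have hn0 : (n : ℝ) ≠ 0 := by
    have := k.pos
    positivity
  rw [sectorPoint, coneX_sq_add_coneY_sq, coneX, coneY, mul_div_mul_left _ _ (coneRadius_pos _).ne',
    ← Real.tan_eq_sin_div_cos, Real.arctan_tan h1 h2, coneAngle, mul_div_cancel₀ _ hc, Real.log_pow,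
    coneRadius, Real.log_exp, pivot_diagonal]
  rw [← Real.exp_log (ha k), hsec k]
  congr 2
  push_cast
  field_simp

/-- The projection to the plane of cone coordinates does not increase length, so a curve from `1`
to `diag d` is at least as long as the straight segment between the projected end points. A curve
for which equality holds runs monotonically through the lift of that segment. -/
theorem length_lower_bound_and_rigidity (hn : 1 ≤ n) (hβ0 : β ≠ 0) (hβ : β < 1 / n)
    (hu : IsDirection u) (hQ : Q ∈ curvesJoining 1 (diagonal d)) {x y ℓ : ℝ}
    (hx : x = coneX β u (diagonal d)) (hy : y = coneY β u (diagonal d)) (hx0 : 0 < x)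
    (hℓ : ℓ = √((x - 1) ^ 2 + y ^ 2)) :
    coneScale n β * ℓ ≤ curveLength β Q ∧ (curveLength β Q = coneScale n β * ℓ →
      ∃ s : ℝ → ℝ, ContinuousOn s (Set.Icc 0 1) ∧ MonotoneOn s (Set.Icc 0 1) ∧ s 0 = 0 ∧ s 1 = 1 ∧
        (∀ t ∈ Set.Icc (0 : ℝ) 1, Q t = sectorCurve β u x y (s t)) ∧
        ((∃ v : ℝ, ∀ t ∈ Set.Icc (0 : ℝ) 1, speed β Q t = v) →
          ∀ t ∈ Set.Icc (0 : ℝ) 1, s t = t)) := by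
  set c := coneScale n β with hc
  have hc0 : 0 < c := coneScale_pos hβ0 hβ
  have m0 : (0 : ℝ) ∈ Set.Icc (0 : ℝ) 1 := ⟨le_rfl, zero_le_one⟩
  have m1 : (1 : ℝ) ∈ Set.Icc (0 : ℝ) 1 := ⟨zero_le_one, le_rfl⟩
  have hℓ2 : ℓ ^ 2 = (x - 1) ^ 2 + y ^ 2 := by rw [hℓ, Real.sq_sqrt (by positivity)]
  -- The unit vector pointing from `(1, 0)` to `(x, y)`; both entries are `0` if `ℓ = 0`.
  set w₁ := (x - 1) / ℓ with hw₁
  set w₂ := y / ℓ with hw₂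
  have hw : w₁ ^ 2 + w₂ ^ 2 = 1 ∨ w₁ = 0 ∧ w₂ = 0 := by
    by_cases h : ℓ = 0
    · right; simp [hw₁, hw₂, h]
    · left
      rw [hw₁, hw₂, div_pow, div_pow, ← add_div, ← hℓ2, div_self (pow_ne_zero 2 h)]
  have hwℓ : w₁ * (x - 1) + w₂ * y = ℓ := by
    by_cases h : ℓ = 0
    · simp [hw₁, hw₂, h]
    · rw [hw₁, hw₂]
      field_simp
      linarith
  choose! x' hx' using fun t (ht : t ∈ Set.Icc (0 : ℝ) 1) =>
    (⟨_, coneX_hasDerivWithinAt (β := β) (u := u) hQ ht⟩ :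
      ∃ x', HasDerivWithinAt (fun s => coneX β u (Q s)) x' (Set.Icc 0 1) t)
  choose! y' hy' using fun t (ht : t ∈ Set.Icc (0 : ℝ) 1) =>
    (⟨_, coneY_hasDerivWithinAt (β := β) (u := u) hQ ht⟩ :
      ∃ y', HasDerivWithinAt (fun s => coneY β u (Q s)) y' (Set.Icc 0 1) t)
  have hcal := fun t (ht : t ∈ Set.Icc (0 : ℝ) 1) =>
    planar_calibration hc0 (coneRadius_pos (β := β) (Q t)) (coneExcess_nonneg (u := u) hQ ht)
      speed_nonneg hw (speed_sq hn hβ0 hβ hu hQ ht (hx' t ht) (hy' t ht))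
  set F : ℝ → ℝ := fun t => c * (w₁ * coneX β u (Q t) + w₂ * coneY β u (Q t)) with hF
  have hFd : ∀ t ∈ Set.Icc (0 : ℝ) 1,
      HasDerivWithinAt F (c * (w₁ * x' t + w₂ * y' t)) (Set.Icc 0 1) t := fun t ht =>
    (((hx' t ht).const_mul w₁).add ((hy' t ht).const_mul w₂)).const_mul c
  have hF01 : F 1 - F 0 = c * ℓ := by
    simp only [hF, hQ.2.2.1, hQ.2.2.2, coneX_one, coneY_one, ← hx, ← hy]
    rw [← hwℓ]
    ring
  obtain ⟨hle, heq⟩ := integral_calibration (continuousOn_speed (β := β) hQ) hFd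
    fun t ht => (hcal t ht).1
  rw [hF01] at hle heq
  refine ⟨hle, fun hlen => ?_⟩
  replace heq := heq hlen.symm
  have hrig := fun t ht => (hcal t ht).2 (heq t ht).1
  -- The planar curve runs along the segment.
  have hXF : ∀ t ∈ Set.Icc (0 : ℝ) 1, coneX β u (Q t) = 1 + (F t - F 0) / c * w₁ := by
    intro t ht
    have := eq_of_hasDerivWithinAt_zero (f := fun t => coneX β u (Q t) - F t / c * w₁)
      (fun t ht => ((hx' t ht).sub (((hFd t ht).div_const c).mul_const w₁)).congr_deriv (by
        rw [mul_div_cancel_left₀ _ hc0.ne', ← (hrig t ht).1, sub_self])) ht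
    simp only [hQ.2.2.1, coneX_one] at this
    linear_combination this
  have hYF : ∀ t ∈ Set.Icc (0 : ℝ) 1, coneY β u (Q t) = (F t - F 0) / c * w₂ := by
    intro t ht
    have := eq_of_hasDerivWithinAt_zero (f := fun t => coneY β u (Q t) - F t / c * w₂)
      (fun t ht => ((hy' t ht).sub (((hFd t ht).div_const c).mul_const w₂)).congr_deriv (by
        rw [mul_div_cancel_left₀ _ hc0.ne', ← (hrig t ht).2.1, sub_self])) ht
    simp only [hQ.2.2.1, coneY_one] at this
    linear_combination this
  -- The curve is diagonal.
  have hexc := fun t ht => coneExcess_eq_zero hQ ht (hrig t ht).2.2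
  have hgs : ∀ t ∈ Set.Icc (0 : ℝ) 1, gsMatrix (Q t) = 1 := by
    intro t ht
    ext i j
    have h := eq_of_hasDerivWithinAt_zero (f := fun t => gsMatrix (Q t) i j)
      (fun t ht => gsMatrix_stationary hQ.1 ht (entryDeriv_velocity hQ ht) (hexc t ht).1 i j) ht
    simp only [hQ.2.2.1] at h
    rw [h, gsMatrix_one]
  have hdiag : ∀ t ∈ Set.Icc (0 : ℝ) 1, Q t = diagonal (pivot (Q t)) := by
    intro t ht
    rw [← gsMatrix_conj (hQ.1 t ht), hgs t ht]
    simp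
  -- The curve stays in the sector spanned by `1` and `u`.
  have hsec : ∀ t ∈ Set.Icc (0 : ℝ) 1, ∀ k, Real.log (pivot (Q t) k) =
      (∑ j, Real.log (pivot (Q t) j)) / n + (∑ j, u j * Real.log (pivot (Q t) j)) * u k := by
    intro t ht k
    have := eq_of_hasDerivWithinAt_zero (f := fun t => Real.log (pivot (Q t) k) -
        ((∑ j, Real.log (pivot (Q t) j)) / n + (∑ j, u j * Real.log (pivot (Q t) j)) * u k))
      (fun t ht => ((logVel_spec hQ ht k).sub
        (((HasDerivWithinAt.fun_sum fun j _ => logVel_spec hQ ht j).div_const _).add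
          ((HasDerivWithinAt.fun_sum fun j _ =>
            (logVel_spec hQ ht j).const_mul (u j)).mul_const _))).congr_deriv
        (sub_eq_zero.2 ((hexc t ht).2 k))) ht
    simp only [hQ.2.2.1, pivot_one, Real.log_one, mul_zero, Finset.sum_const_zero,
      zero_div, zero_mul, add_zero, sub_zero] at this
    linarith
  -- The reparametrization; `s = id` if the segment is a point.
  set s : ℝ → ℝ := fun t => if ℓ = 0 then t else (F t - F 0) / (c * ℓ) with hs
  have hFmono : MonotoneOn F (Set.Icc 0 1) :=
    monotoneOn_of_hasDerivWithinAt_nonneg hFd fun t ht => by rw [(heq t ht).1]; exact speed_nonneg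
  have hℓ0 : 0 ≤ ℓ := hℓ ▸ Real.sqrt_nonneg _
  have hsmono : MonotoneOn s (Set.Icc 0 1) := by
    intro a ha b hb hab
    simp only [hs]
    split_ifs with h
    · exact hab
    · have := hFmono ha hb hab
      gcongr
  have hs0 : s 0 = 0 := by simp [hs]
  have hs1 : s 1 = 1 := by
    simp only [hs]
    split_ifs with h
    · rfl
    · rw [hF01, div_self (mul_ne_zero hc0.ne' h)]
  have hxy0 : ℓ = 0 → x = 1 ∧ y = 0 := by
    intro h
    rw [h] at hℓ2
    constructor <;> nlinarith [sq_nonneg (x - 1), sq_nonneg y]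
  have hXs : ∀ t ∈ Set.Icc (0 : ℝ) 1, coneX β u (Q t) = 1 - s t + s t * x := by
    intro t ht
    rw [hXF t ht]
    by_cases h : ℓ = 0
    · simp [hw₁, h, (hxy0 h).1]
    · simp only [hs, if_neg h, hw₁]
      field_simp
      ring
  have hYs : ∀ t ∈ Set.Icc (0 : ℝ) 1, coneY β u (Q t) = s t * y := by
    intro t ht
    rw [hYF t ht]
    by_cases h : ℓ = 0
    · simp [hw₂, h, (hxy0 h).2]
    · simp only [hs, if_neg h, hw₂]
      field_simp
  have hcos : ∀ t ∈ Set.Icc (0 : ℝ) 1, 0 < Real.cos (coneAngle β u (Q t)) := by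
    intro t ht
    have h1 := hXs t ht
    have h2 : 0 ≤ s t := hs0 ▸ hsmono m0 ht ht.1
    have h3 : s t ≤ 1 := hs1 ▸ hsmono ht m1 ht.2
    have h4 : 0 < coneX β u (Q t) := by
      rw [h1]
      rcases h2.eq_or_lt with h | h
      · rw [← h]; norm_num
      · have := mul_pos h hx0
        linarith
    exact pos_of_mul_pos_right h4 (coneRadius_pos (β := β) _).le
  have hang : ∀ t ∈ Set.Icc (0 : ℝ) 1, |coneAngle β u (Q t)| < Real.pi / 2 := fun t ht =>
    abs_lt_pi_div_two_of_cos_pos (θ := fun t => coneAngle β u (Q t))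
      (fun t ht => (coneAngle_hasDerivWithinAt hQ ht).continuousWithinAt)
      (by simp [hQ.2.2.1, coneAngle, pivot_one]) hcos ht
  refine ⟨s, ?_, hsmono, hs0, hs1, fun t ht => ?_, ?_⟩
  · simp only [hs]
    split_ifs with h
    · exact continuousOn_id
    · exact ContinuousOn.div_const
        (ContinuousOn.sub (fun t ht => (hFd t ht).continuousWithinAt) continuousOn_const) _
  · have hd := hdiag t ht
    have hpt := eq_sectorPoint (β := β) hβ0 hβ (pivot_pos (hQ.1 t ht)) (hsec t ht)
      (by rw [← hd]; exact hang t ht)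
    rw [← hd, hXs t ht, hYs t ht] at hpt
    rw [hd, hpt]
    rfl
  · rintro ⟨v, hv⟩ t ht
    have hFv : ∀ t ∈ Set.Icc (0 : ℝ) 1, F t - F 0 = t * v := by
      intro t ht
      rw [(heq t ht).2, intervalIntegral.integral_congr (g := fun _ => v)]
      · simp
      · intro r hr
        rw [Set.uIcc_of_le ht.1] at hr
        exact hv r ⟨hr.1, hr.2.trans ht.2⟩
    simp only [hs]
    split_ifs with h
    · rfl
    · have h1 := hFv 1 m1
      rw [hF01, one_mul] at h1
      rw [hFv t ht, h1, mul_div_cancel_right₀]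
      rw [← h1]
      exact mul_ne_zero hc0.ne' h

end Normalized

/-! ### The lifted segments are minimal -/

section Sector

variable {n : ℕ} {β : ℝ} {u d : Fin n → ℝ} {Q : ℝ → Matrix (Fin n) (Fin n) ℝ} {t x y : ℝ}

theorem log_sectorPoint (β : ℝ) (u : Fin n → ℝ) (x y : ℝ) (k : Fin n) :
    Real.log (sectorPoint β u x y k) =
      1 / (n * β) * Real.log (x ^ 2 + y ^ 2) + coneScale n β * Real.arctan (y / x) * u k := by
  rw [sectorPoint, Real.log_exp]

theorem sum_log_sectorPoint (hn : 1 ≤ n) (hu : IsDirection u) (hβ0 : β ≠ 0) :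
    ∑ k, Real.log (sectorPoint β u x y k) = 1 / β * Real.log (x ^ 2 + y ^ 2) := by
  simp only [log_sectorPoint, Finset.sum_add_distrib, ← Finset.mul_sum, hu.sum_eq_zero,
    Finset.sum_const, Finset.card_univ, Fintype.card_fin, nsmul_eq_mul, mul_zero, add_zero]
  have hn0 : (n : ℝ) ≠ 0 := by positivity
  field_simp

theorem sum_mul_log_sectorPoint (hu : IsDirection u) :
    ∑ k, u k * Real.log (sectorPoint β u x y k) =
      coneScale n β * Real.arctan (y / x) * ∑ k, u k ^ 2 := by
  have e : ∀ k, u k * Real.log (sectorPoint β u x y k) =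
      1 / (n * β) * Real.log (x ^ 2 + y ^ 2) * u k +
        coneScale n β * Real.arctan (y / x) * u k ^ 2 := fun k => by
    rw [log_sectorPoint]; ring
  simp only [e, Finset.sum_add_distrib, ← Finset.mul_sum, hu.sum_eq_zero, mul_zero, zero_add]

theorem log_sectorPoint_eq (hn : 1 ≤ n) (hu : IsDirection u) (hβ0 : β ≠ 0) (k : Fin n) :
    Real.log (sectorPoint β u x y k) = (∑ j, Real.log (sectorPoint β u x y j)) / n +
      (∑ j, u j * Real.log (sectorPoint β u x y j)) * u k := by
  rw [sum_log_sectorPoint hn hu hβ0, sum_mul_log_sectorPoint hu, log_sectorPoint]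
  have hn0 : (n : ℝ) ≠ 0 := by positivity
  rcases hu.unit_or_zero with h | h
  · rw [h]
    field_simp
  · simp only [h, Pi.zero_apply]
    field_simp
    ring

/-- The point `(x, y)` in polar coordinates, in the right half plane. -/
theorem sqrt_mul_cos_sin_arctan (hx : 0 < x) :
    √(x ^ 2 + y ^ 2) * Real.cos (Real.arctan (y / x)) = x ∧
      √(x ^ 2 + y ^ 2) * Real.sin (Real.arctan (y / x)) = y := by
  have h : √(x ^ 2 + y ^ 2) = x * √(1 + (y / x) ^ 2) := by
    rw [← Real.sqrt_sq hx.le, ← Real.sqrt_mul (by positivity), Real.sqrt_sq hx.le]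
    congr 1
    field_simp
  have h1 : √(1 + (y / x) ^ 2) ≠ 0 := by positivity
  rw [Real.cos_arctan, Real.sin_arctan, h]
  constructor <;> field_simp

/-- The planar coordinates of a point of the sector. If `u = 0` there is no angle, and the sector
lies over the ray `y = 0`. -/
theorem cone_sectorPoint (hn : 1 ≤ n) (hβ0 : β ≠ 0) (hβ : β < 1 / n) (hu : IsDirection u)
    (hx : 0 < x) (hy : u = 0 → y = 0) :
    coneX β u (diagonal (sectorPoint β u x y)) = x ∧
      coneY β u (diagonal (sectorPoint β u x y)) = y := by
  have hc := (coneScale_pos hβ0 hβ).ne'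
  have hrad : coneRadius β (diagonal (sectorPoint β u x y)) = √(x ^ 2 + y ^ 2) := by
    rw [coneRadius, pivot_diagonal, sum_log_sectorPoint hn hu hβ0, ← Real.exp_log
      (Real.sqrt_pos.2 (by positivity : 0 < x ^ 2 + y ^ 2)), Real.log_sqrt (by positivity)]
    congr 1
    field_simp
  have hang : coneAngle β u (diagonal (sectorPoint β u x y)) = Real.arctan (y / x) := by
    rw [coneAngle, pivot_diagonal, sum_mul_log_sectorPoint hu]
    rcases hu.unit_or_zero with h | h
    · rw [h]
      field_simp
    · simp [h, hy h]
  rw [coneX, coneY, hrad, hang]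
  exact sqrt_mul_cos_sin_arctan hx

theorem segment_pos {s : ℝ} (hx : 0 < x) (hs : s ∈ Set.Icc (0 : ℝ) 1) : 0 < 1 - s + s * x := by
  rcases hs.1.eq_or_lt with h | h
  · rw [← h]; norm_num
  · have := mul_pos h hx
    linarith [hs.2]

theorem sectorCurve_mem (hβ0 : β ≠ 0) (hβ : β < 1 / n) (hd : ∀ k, 0 < d k)
    (hsec : ∀ k, Real.log (d k) =
      (∑ j, Real.log (d j)) / n + (∑ j, u j * Real.log (d j)) * u k)
    (hθ : |coneAngle β u (diagonal d)| < Real.pi / 2)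
    (hx : x = coneX β u (diagonal d)) (hy : y = coneY β u (diagonal d)) (hx0 : 0 < x) :
    sectorCurve β u x y ∈ curvesJoining 1 (diagonal d) := by
  refine ⟨fun s _ => PosDef.diagonal fun k => Real.exp_pos _, fun i j => ?_, ?_, ?_⟩
  · by_cases hij : i = j
    · subst hij
      simp only [sectorCurve, diagonal_apply_eq, sectorPoint]
      have hX : ContDiffOn ℝ 2 (fun s : ℝ => 1 - s + s * x) (Set.Icc 0 1) := by fun_prop
      have hY : ContDiffOn ℝ 2 (fun s : ℝ => s * y) (Set.Icc 0 1) := by fun_prop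
      have hpos : ∀ s ∈ Set.Icc (0 : ℝ) 1, 1 - s + s * x ≠ 0 := fun s hs =>
        (segment_pos hx0 hs).ne'
      refine ContDiffOn.exp (ContDiffOn.add (contDiffOn_const.mul (ContDiffOn.log
        ((hX.pow 2).add (hY.pow 2)) fun s hs => ?_))
        ((contDiffOn_const.mul ?_).mul contDiffOn_const))
      · have := segment_pos hx0 hs
        positivity
      · exact Real.contDiff_arctan.comp_contDiffOn (hY.div hX hpos)
    · simp only [sectorCurve, diagonal_apply_ne _ hij]
      exact contDiffOn_const
  · rw [sectorCurve, ← diagonal_one]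
    congr 1
    ext k
    simp [sectorPoint]
  · rw [sectorCurve, sub_self, zero_add, one_mul, one_mul, hx, hy,
      ← eq_sectorPoint hβ0 hβ hd hsec hθ]

/-- Curves of diagonal matrices in the sector spanned by `1` and `u` have no excess. -/
theorem coneExcess_of_sector {A B : Matrix (Fin n) (Fin n) ℝ} (hQ : Q ∈ curvesJoining A B)
    {a : ℝ → Fin n → ℝ} (hQa : ∀ t, Q t = diagonal (a t))
    (hsec : ∀ t ∈ Set.Icc (0 : ℝ) 1, ∀ k, Real.log (a t k) =
      (∑ j, Real.log (a t j)) / n + (∑ j, u j * Real.log (a t j)) * u k)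
    (ht : t ∈ Set.Icc (0 : ℝ) 1) : coneExcess u Q t = 0 := by
  have hoff : ∀ k l, k ≠ l → frameVel Q t k l = 0 := by
    intro k l hkl
    rw [frameVel, hQa, gsMatrix_diagonal, transpose_one, Matrix.one_mul, Matrix.mul_one]
    have : (fun s => Q s k l) = fun _ => (0 : ℝ) := by
      ext s
      rw [hQa, diagonal_apply_ne _ hkl]
    simp [velocity, this]
  have hlog : ∀ k, logVel Q t k =
      (∑ j, logVel Q t j) / n + (∑ j, u j * logVel Q t j) * u k := by
    intro k
    have h := ((HasDerivWithinAt.fun_sum fun j (_ : j ∈ Finset.univ) =>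
        logVel_spec hQ ht j).div_const (n : ℝ)).add
      ((HasDerivWithinAt.fun_sum fun j (_ : j ∈ Finset.univ) =>
        (logVel_spec hQ ht j).const_mul (u j)).mul_const (u k))
    refine (uniqueDiff_unitInterval ht).eq_deriv _ (logVel_spec hQ ht k) (h.congr ?_ ?_)
    · intro s hs
      simpa only [hQa, pivot_diagonal, Pi.add_apply] using hsec s hs k
    · simpa only [hQa, pivot_diagonal, Pi.add_apply] using hsec t ht k
  rw [coneExcess, Finset.sum_eq_zero, Finset.sum_eq_zero, add_zero]
  · intro k _
    rw [sub_sub, ← hlog k, sub_self, zero_pow two_ne_zero]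
  · intro k _
    refine Finset.sum_eq_zero fun l _ => ?_
    split_ifs with h
    · rfl
    · rw [hoff k l h, zero_pow two_ne_zero, zero_div]

theorem sectorCurve_speed (hn : 1 ≤ n) (hβ0 : β ≠ 0) (hβ : β < 1 / n) (hu : IsDirection u)
    (hx0 : 0 < x) (hy0 : u = 0 → y = 0) {A B : Matrix (Fin n) (Fin n) ℝ}
    (hmem : sectorCurve β u x y ∈ curvesJoining A B) (ht : t ∈ Set.Icc (0 : ℝ) 1) :
    speed β (sectorCurve β u x y) t = coneScale n β * √((x - 1) ^ 2 + y ^ 2) := by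
  have hcone := fun s (hs : s ∈ Set.Icc (0 : ℝ) 1) =>
    cone_sectorPoint hn hβ0 hβ hu (segment_pos hx0 hs) (y := s * y) fun h => by
      rw [hy0 h, mul_zero]
  have hX : HasDerivWithinAt (fun s => coneX β u (sectorCurve β u x y s)) (x - 1)
      (Set.Icc 0 1) t := by
    have h : HasDerivWithinAt (fun s : ℝ => 1 - s + s * x) (x - 1) (Set.Icc 0 1) t :=
      (((hasDerivWithinAt_id t _).const_sub 1).add
        ((hasDerivWithinAt_id t _).mul_const x)).congr_deriv (by ring)
    exact h.congr (fun s hs => (hcone s hs).1) (hcone t ht).1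
  have hY : HasDerivWithinAt (fun s => coneY β u (sectorCurve β u x y s)) y
      (Set.Icc 0 1) t := by
    have h : HasDerivWithinAt (fun s : ℝ => s * y) y (Set.Icc 0 1) t :=
      ((hasDerivWithinAt_id t _).mul_const y).congr_deriv (by ring)
    exact h.congr (fun s hs => (hcone s hs).2) (hcone t ht).2
  have hE := coneExcess_of_sector (u := u) hmem (fun _ => rfl)
    (fun s _ k => log_sectorPoint_eq hn hu hβ0 k) ht
  have hsq := speed_sq hn hβ0 hβ hu hmem ht hX hY
  rw [hE, mul_zero, add_zero] at hsq
  have hc := coneScale_pos hβ0 hβ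
  rw [← Real.sqrt_sq (speed_nonneg (β := β) (Q := sectorCurve β u x y) (t := t)), hsq,
    Real.sqrt_mul (by positivity), Real.sqrt_sq hc.le]

end Sector

/-! ### Congruence -/

section Congruence

variable {n : ℕ} {β : ℝ} {A B N : Matrix (Fin n) (Fin n) ℝ}
  {P : ℝ → Matrix (Fin n) (Fin n) ℝ} {t : ℝ}

theorem EntryDeriv.congruence {H : Matrix (Fin n) (Fin n) ℝ} (h : EntryDeriv P H t)
    (N : Matrix (Fin n) (Fin n) ℝ) : EntryDeriv (fun s => Nᵀ * P s * N) (Nᵀ * H * N) t := by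
  simpa using ((EntryDeriv.const Nᵀ t).mul h).mul (EntryDeriv.const N t)

theorem curvesJoining_congruence (hN : IsUnit N.det) (hP : P ∈ curvesJoining A B) :
    (fun s => Nᵀ * P s * N) ∈ curvesJoining (Nᵀ * A * N) (Nᵀ * B * N) := by
  refine ⟨fun s hs => ?_, fun i j => ?_, by simp only [hP.2.2.1], by simp only [hP.2.2.2]⟩
  · have := (hP.1 s hs).conjTranspose_mul_mul_same (B := N)
      (mulVec_injective_of_isUnit ((isUnit_iff_isUnit_det N).2 hN))
    simpa using this
  · simp only [Matrix.mul_apply]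
    exact ContDiffOn.sum fun k _ => ContDiffOn.mul (ContDiffOn.sum fun l _ =>
      contDiffOn_const.mul (hP.2.1 l k)) contDiffOn_const

theorem metric_congruence (hN : IsUnit N.det) {X : Matrix (Fin n) (Fin n) ℝ} (hX : X.PosDef)
    (H : Matrix (Fin n) (Fin n) ℝ) :
    metric β (Nᵀ * X * N) (Nᵀ * H * N) (Nᵀ * H * N) = (N.det ^ 2) ^ β * metric β X H H := by
  have hNt : IsUnit Nᵀ.det := by rwa [det_transpose]
  have h1 : (Nᵀ * X * N)⁻¹ * (Nᵀ * H * N) = N⁻¹ * (X⁻¹ * H) * N := by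
    rw [Matrix.mul_inv_rev, Matrix.mul_inv_rev]
    simp only [Matrix.mul_assoc]
    rw [nonsing_inv_mul_cancel_left _ _ hNt]
  have htr : ∀ Y : Matrix (Fin n) (Fin n) ℝ, (N⁻¹ * Y * N).trace = Y.trace := fun Y => by
    rw [trace_mul_comm, ← Matrix.mul_assoc, mul_nonsing_inv _ hN, Matrix.one_mul]
  have h2 : N⁻¹ * (X⁻¹ * H) * N * (N⁻¹ * (X⁻¹ * H) * N) =
      N⁻¹ * (X⁻¹ * H * (X⁻¹ * H)) * N := by
    simp only [Matrix.mul_assoc]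
    rw [mul_nonsing_inv_cancel_left _ _ hN]
  have hdet : (Nᵀ * X * N).det = N.det ^ 2 * X.det := by
    rw [det_mul, det_mul, det_transpose]; ring
  rw [metric, metric, Matrix.mul_assoc _ (Nᵀ * X * N)⁻¹, h1, h2, htr, htr, hdet,
    Real.mul_rpow (by positivity) hX.det_pos.le, Matrix.mul_assoc _ X⁻¹ H, mul_assoc]

theorem speed_congruence (hN : IsUnit N.det) (hP : P ∈ curvesJoining A B)
    (ht : t ∈ Set.Icc (0 : ℝ) 1) :
    speed β (fun s => Nᵀ * P s * N) t = √((N.det ^ 2) ^ β) * speed β P t := by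
  rw [speed, ((entryDeriv_velocity hP ht).congruence N).eq_velocity ht,
    metric_congruence hN (hP.1 t ht), Real.sqrt_mul (by positivity), speed]

theorem curveLength_congruence (hN : IsUnit N.det) (hP : P ∈ curvesJoining A B) :
    curveLength β (fun s => Nᵀ * P s * N) = √((N.det ^ 2) ^ β) * curveLength β P := by
  rw [curveLength, curveLength, ← intervalIntegral.integral_const_mul]
  refine intervalIntegral.integral_congr fun s hs => ?_
  rw [Set.uIcc_of_le zero_le_one] at hs
  exact speed_congruence hN hP hs

/-- Simultaneous diagonalization of two positive-definite forms. -/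
theorem exists_simultaneous_diagonalization (hA : A.PosDef) (hB : B.PosDef) :
    ∃ (M : Matrix (Fin n) (Fin n) ℝ) (d : Fin n → ℝ), IsUnit M.det ∧ (∀ k, 0 < d k) ∧
      A = Mᵀ * M ∧ B = Mᵀ * diagonal d * M := by
  have hD := pivot_pos hA
  set W := gsMatrix A * diagonal (fun k => (√(pivot A k))⁻¹) with hW
  have hWu : IsUnit W.det := by
    rw [hW, det_mul, det_gsMatrix, det_diagonal, one_mul, isUnit_iff_ne_zero]
    exact Finset.prod_ne_zero_iff.2 fun k _ => (inv_pos.2 (Real.sqrt_pos.2 (hD k))).ne'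
  have hWA : Wᵀ * A * W = 1 := by
    have : Wᵀ * A * W = diagonal (fun k => (√(pivot A k))⁻¹) *
        ((gsMatrix A)ᵀ * A * gsMatrix A) * diagonal (fun k => (√(pivot A k))⁻¹) := by
      rw [hW, transpose_mul, diagonal_transpose]
      simp only [Matrix.mul_assoc]
    rw [this, gsMatrix_conj hA, diagonal_mul_diagonal, diagonal_mul_diagonal, ← diagonal_one]
    congr 1
    ext k
    have h := Real.mul_self_sqrt (hD k).le
    have h0 := (Real.sqrt_pos.2 (hD k)).ne'
    field_simp
    rw [sq, h]
  have hC : (Wᵀ * B * W).PosDef := by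
    have := hB.conjTranspose_mul_mul_same (B := W)
      (mulVec_injective_of_isUnit ((isUnit_iff_isUnit_det W).2 hWu))
    simpa using this
  set O : Matrix (Fin n) (Fin n) ℝ := hC.isHermitian.eigenvectorUnitary.1 with hO
  have hOO : Oᵀ * O = 1 := by
    have := Unitary.coe_star_mul_self hC.isHermitian.eigenvectorUnitary
    simpa [star_eq_conjTranspose] using this
  obtain ⟨e, he, hspec⟩ : ∃ e : Fin n → ℝ, (∀ k, 0 < e k) ∧
      Wᵀ * B * W = O * diagonal e * Oᵀ := by
    refine ⟨_, hC.eigenvalues_pos, ?_⟩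
    have := hC.isHermitian.spectral_theorem
    rw [Unitary.conjStarAlgAut_apply] at this
    simpa [star_eq_conjTranspose, Function.comp_def] using this
  have hOu : IsUnit O.det := (isUnit_iff_isUnit_det O).1 (IsUnit.of_mul_eq_one_right _ hOO)
  have hNu : IsUnit (W * O).det := by rw [det_mul]; exact hWu.mul hOu
  have hNA : (W * O)ᵀ * A * (W * O) = 1 := by
    have : (W * O)ᵀ * A * (W * O) = Oᵀ * (Wᵀ * A * W) * O := by
      rw [transpose_mul]; simp only [Matrix.mul_assoc]
    rw [this, hWA, Matrix.mul_one, hOO]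
  have hNB : (W * O)ᵀ * B * (W * O) = diagonal e := by
    have : (W * O)ᵀ * B * (W * O) = Oᵀ * (Wᵀ * B * W) * O := by
      rw [transpose_mul]; simp only [Matrix.mul_assoc]
    rw [this, hspec]
    have h2 : Oᵀ * (O * diagonal e * Oᵀ) * O =
        (Oᵀ * O) * diagonal e * (Oᵀ * O) := by
      simp only [Matrix.mul_assoc]
    rw [h2, hOO, Matrix.one_mul, Matrix.mul_one]
  have hNt : IsUnit (W * O)ᵀ.det := by rwa [det_transpose]
  refine ⟨(W * O)⁻¹, e, isUnit_nonsing_inv_det _ hNu,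
    he, ?_, ?_⟩
  · rw [← Matrix.mul_one ((W * O)⁻¹)ᵀ, ← hNA, transpose_nonsing_inv]
    simp only [Matrix.mul_assoc (W * O)ᵀ, nonsing_inv_mul_cancel_left _ _ hNt]
    rw [mul_nonsing_inv_cancel_right _ _ hNu]
  · rw [← hNB, transpose_nonsing_inv]
    simp only [Matrix.mul_assoc (W * O)ᵀ, nonsing_inv_mul_cancel_left _ _ hNt]
    rw [mul_nonsing_inv_cancel_right _ _ hNu]

end Congruence

/-! ### The distinguished direction -/

section Direction

variable {n : ℕ} {β : ℝ} {d : Fin n → ℝ}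

/-- The mean of the logarithms of `d`. -/
noncomputable def logMean {n : ℕ} (d : Fin n → ℝ) : ℝ := (∑ k, Real.log (d k)) / n

/-- The Euclidean norm of the trace-free part of `log d`. -/
noncomputable def logDev {n : ℕ} (d : Fin n → ℝ) : ℝ := √(∑ k, (Real.log (d k) - logMean d) ^ 2)

/-- The direction of the trace-free part of `log d`, which is zero if that part vanishes. -/
noncomputable def logDir {n : ℕ} (d : Fin n → ℝ) (k : Fin n) : ℝ :=
  (Real.log (d k) - logMean d) / logDev d

theorem logDev_sq (d : Fin n → ℝ) : logDev d ^ 2 = ∑ k, (Real.log (d k) - logMean d) ^ 2 :=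
  Real.sq_sqrt (Finset.sum_nonneg fun _ _ => sq_nonneg _)

theorem logDev_nonneg (d : Fin n → ℝ) : 0 ≤ logDev d := Real.sqrt_nonneg _

theorem log_eq_logMean_add (d : Fin n → ℝ) (k : Fin n) :
    Real.log (d k) = logMean d + logDev d * logDir d k := by
  rw [logDir]
  by_cases h : logDev d = 0
  · have h1 := logDev_sq d
    rw [h, zero_pow two_ne_zero, eq_comm,
      Finset.sum_eq_zero_iff_of_nonneg fun _ _ => sq_nonneg _] at h1
    have := pow_eq_zero_iff two_ne_zero |>.1 (h1 k (Finset.mem_univ k))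
    rw [h]
    linarith
  · field_simp
    ring

theorem sum_log_eq (hn : 1 ≤ n) (d : Fin n → ℝ) : ∑ k, Real.log (d k) = n * logMean d := by
  have hn0 : (n : ℝ) ≠ 0 := by positivity
  rw [logMean, mul_div_cancel₀ _ hn0]

theorem isDirection_logDir (hn : 1 ≤ n) (d : Fin n → ℝ) : IsDirection (logDir d) := by
  constructor
  · simp only [logDir, ← Finset.sum_div, Finset.sum_sub_distrib, sum_log_eq hn, Finset.sum_const,
      Finset.card_univ, Fintype.card_fin, nsmul_eq_mul, sub_self, zero_div]
  · by_cases h : logDev d = 0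
    · right
      ext k
      simp [logDir, h]
    · left
      simp only [logDir, div_pow, ← Finset.sum_div, ← logDev_sq]
      exact div_self (pow_ne_zero 2 h)

theorem sum_logDir_mul_log (hn : 1 ≤ n) (d : Fin n → ℝ) :
    ∑ k, logDir d k * Real.log (d k) = logDev d := by
  have hu := isDirection_logDir hn d
  have e : ∀ k, logDir d k * Real.log (d k) = logMean d * logDir d k + logDev d * logDir d k ^ 2 :=
    fun k => by rw [log_eq_logMean_add]; ring
  simp only [e, Finset.sum_add_distrib, ← Finset.mul_sum, hu.sum_eq_zero, mul_zero, zero_add]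
  rcases hu.unit_or_zero with h | h
  · rw [h, mul_one]
  · by_cases hdev : logDev d = 0
    · rw [hdev, zero_mul]
    · have h1 := logDev_sq d
      have h2 : ∀ k, Real.log (d k) - logMean d = 0 := fun k => by
        have := log_eq_logMean_add d k
        rw [h, Pi.zero_apply, mul_zero, add_zero] at this
        rw [this, sub_self]
      simp only [h2, zero_pow two_ne_zero, Finset.sum_const_zero] at h1
      exact absurd (pow_eq_zero_iff two_ne_zero |>.1 h1) hdev

theorem coneAngle_logDir (hn : 1 ≤ n) (d : Fin n → ℝ) :
    coneAngle β (logDir d) (diagonal d) = logDev d / coneScale n β := by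
  rw [coneAngle, pivot_diagonal, sum_logDir_mul_log hn]

end Direction

/-! ### The invariants of a pair in simultaneous diagonal form -/

section Invariants

variable {n : ℕ} {β : ℝ} {M : Matrix (Fin n) (Fin n) ℝ} {d : Fin n → ℝ}

theorem inv_mul_of_congruence (hM : IsUnit M.det) :
    (Mᵀ * M)⁻¹ * (Mᵀ * diagonal d * M) = M⁻¹ * diagonal d * M := by
  have hMt : IsUnit Mᵀ.det := by rwa [det_transpose]
  rw [Matrix.mul_inv_rev]
  simp only [Matrix.mul_assoc]
  rw [nonsing_inv_mul_cancel_left _ _ hMt]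

theorem roots_charpoly_conj_diagonal (hM : IsUnit M.det) (d : Fin n → ℝ) :
    (M⁻¹ * diagonal d * M).charpoly.roots = Finset.univ.val.map d := by
  obtain ⟨U, rfl⟩ := (isUnit_iff_isUnit_det M).2 hM
  rw [charpoly_units_conj', charpoly_diagonal]
  exact Polynomial.roots_multiset_prod_X_sub_C (Finset.univ.val.map d) ▸ by
    rw [Multiset.map_map]; rfl

theorem traceDist_of_congruence (hM : IsUnit M.det) (hd : ∀ k, 0 < d k) :
    traceDist ((Mᵀ * M).det ^ (-(1 / (n : ℝ))) • (Mᵀ * M))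
      ((Mᵀ * diagonal d * M).det ^ (-(1 / (n : ℝ))) • (Mᵀ * diagonal d * M)) = logDev d := by
  have hdet : 0 < M.det ^ 2 := by
    have := hM.ne_zero
    positivity
  have hprod : 0 < ∏ k, d k := Finset.prod_pos fun k _ => hd k
  have hdA : (Mᵀ * M).det = M.det ^ 2 := by rw [det_mul, det_transpose, sq]
  have hdB : (Mᵀ * diagonal d * M).det = M.det ^ 2 * ∏ k, d k := by
    rw [det_mul, det_mul, det_transpose, det_diagonal]; ring
  set a := (Mᵀ * M).det ^ (-(1 / (n : ℝ))) with ha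
  set b := (Mᵀ * diagonal d * M).det ^ (-(1 / (n : ℝ))) with hb
  have ha0 : 0 < a := Real.rpow_pos_of_pos (hdA ▸ hdet) _
  have hb0 : 0 < b := Real.rpow_pos_of_pos (hdB ▸ mul_pos hdet hprod) _
  have hlog : Real.log (a⁻¹ * b) = -logMean d := by
    rw [Real.log_mul (by positivity) (by positivity), Real.log_inv, ha, hb,
      Real.log_rpow (hdA ▸ hdet), Real.log_rpow (hdB ▸ mul_pos hdet hprod), hdA, hdB,
      Real.log_mul hdet.ne' hprod.ne', Real.log_prod fun k _ => (hd k).ne', logMean]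
    ring
  have hu : IsUnit (Mᵀ * M).det := by rw [hdA]; exact hdet.ne'.isUnit
  have hmat : (a • (Mᵀ * M))⁻¹ * (b • (Mᵀ * diagonal d * M)) =
      M⁻¹ * diagonal (fun k => a⁻¹ * b * d k) * M := by
    have h1 : (a • (Mᵀ * M))⁻¹ = a⁻¹ • (Mᵀ * M)⁻¹ := by
      refine inv_eq_right_inv ?_
      rw [smul_mul_smul_comm, mul_inv_cancel₀ ha0.ne', mul_nonsing_inv _ hu, one_smul]
    have h2 : diagonal (fun k => a⁻¹ * b * d k) = (a⁻¹ * b) • diagonal d := by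
      rw [← diagonal_smul]; rfl
    rw [h1, smul_mul_smul_comm, inv_mul_of_congruence hM, h2, Matrix.mul_smul, Matrix.smul_mul]
  rw [traceDist, hmat, roots_charpoly_conj_diagonal hM, Multiset.map_map, logDev]
  congr 1
  refine Finset.sum_congr rfl fun k _ => ?_
  simp only [Function.comp_apply]
  rw [Real.log_mul (by positivity) (hd k).ne', hlog]
  ring

theorem gammaDist_of_congruence (hM : IsUnit M.det) (hd : ∀ k, 0 < d k) :
    gammaDist β (Mᵀ * M) (Mᵀ * diagonal d * M) = logDev d / coneScale n β := by
  rw [gammaDist, traceDist_of_congruence hM hd, coneScale, div_div_eq_mul_div, mul_comm]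

theorem sigmaRatio_of_congruence (hM : IsUnit M.det) (hd : ∀ k, 0 < d k) :
    sigmaRatio β (Mᵀ * M) (Mᵀ * diagonal d * M) = coneRadius β (diagonal d) := by
  rw [sigmaRatio, inv_mul_of_congruence hM, det_mul, det_mul, mul_right_comm, ← det_mul,
    nonsing_inv_mul _ hM, det_one, one_mul, det_diagonal,
    Real.rpow_def_of_pos (Finset.prod_pos fun k _ => hd k), Real.log_prod fun k _ => (hd k).ne',
    coneRadius, pivot_diagonal, mul_comm]

theorem log_coneRadius_diagonal (hn : 1 ≤ n) (d : Fin n → ℝ) :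
    Real.log (coneRadius β (diagonal d)) = β / 2 * (n * logMean d) := by
  rw [coneRadius, Real.log_exp, pivot_diagonal, sum_log_eq hn]

end Invariants

/-! ### Explicit formulas -/

section Formulas

variable {n : ℕ} {β : ℝ} {M : Matrix (Fin n) (Fin n) ℝ} {d : Fin n → ℝ} {t : ℝ}

theorem formula_of_gamma_ne_zero (hn : 1 ≤ n) (hβ0 : β ≠ 0) (hM : IsUnit M.det)
    (hd : ∀ k, 0 < d k)
    (hx0 : 0 < coneX β (logDir d) (diagonal d))
    (hγ : gammaDist β (Mᵀ * M) (Mᵀ * diagonal d * M) ≠ 0) (ht : t ∈ Set.Icc (0 : ℝ) 1) :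
    Mᵀ * sectorCurve β (logDir d) (coneX β (logDir d) (diagonal d))
        (coneY β (logDir d) (diagonal d)) t * M =
      etaFun β (Mᵀ * M) (Mᵀ * diagonal d * M) t • geoMean (Mᵀ * M) (Mᵀ * diagonal d * M)
        (alphaFun β (Mᵀ * M) (Mᵀ * diagonal d * M) t) := by
  have hn0 : (n : ℝ) ≠ 0 := by positivity
  have hMt : IsUnit Mᵀ.det := by rwa [det_transpose]
  have hσ0 := coneRadius_pos (β := β) (diagonal d)
  have hγd := gammaDist_of_congruence (β := β) hM hd
  set γ := gammaDist β (Mᵀ * M) (Mᵀ * diagonal d * M) with hγdef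
  have hang : coneAngle β (logDir d) (diagonal d) = γ := by rw [hγd, coneAngle_logDir hn]
  have hα : alphaFun β (Mᵀ * M) (Mᵀ * diagonal d * M) t = 1 / γ * Real.arctan
      (t * coneY β (logDir d) (diagonal d) /
        (1 - t + t * coneX β (logDir d) (diagonal d))) := by
    rw [alphaFun, sigmaRatio_of_congruence hM hd, ← hγdef, coneX, coneY, hang]
    simp only [mul_assoc]
  set α := alphaFun β (Mᵀ * M) (Mᵀ * diagonal d * M) t with hαdef
  have hη : etaFun β (Mᵀ * M) (Mᵀ * diagonal d * M) t =
      (((1 - t + t * coneX β (logDir d) (diagonal d)) ^ 2 +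
        (t * coneY β (logDir d) (diagonal d)) ^ 2) /
          coneRadius β (diagonal d) ^ (2 * α)) ^ (1 / ((n : ℝ) * β)) := by
    rw [etaFun, sigmaRatio_of_congruence hM hd, ← hγdef, ← hαdef, coneX, coneY, hang]
    congr 2
    linear_combination -(t * coneRadius β (diagonal d)) ^ 2 * Real.sin_sq_add_cos_sq γ
  have hρ : 0 < (1 - t + t * coneX β (logDir d) (diagonal d)) ^ 2 +
      (t * coneY β (logDir d) (diagonal d)) ^ 2 := by
    have := segment_pos hx0 ht
    positivity
  have hdiag : IsPosDiagonalization ((Mᵀ * M)⁻¹ * (Mᵀ * diagonal d * M)) M d :=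
    ⟨hM, hd, inv_mul_of_congruence hM⟩
  have hc : coneScale n β ≠ 0 := by
    rintro h
    rw [h, div_zero] at hγd
    exact hγ hγd
  have hpt : sectorPoint β (logDir d) (1 - t + t * coneX β (logDir d) (diagonal d))
      (t * coneY β (logDir d) (diagonal d)) =
      fun k => etaFun β (Mᵀ * M) (Mᵀ * diagonal d * M) t * d k ^ α := by
    ext k
    rw [hη, Real.rpow_def_of_pos (by positivity), Real.rpow_def_of_pos (hd k), ← Real.exp_add,
      Real.log_div hρ.ne' (by positivity), Real.log_rpow hσ0, log_coneRadius_diagonal hn,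
      log_eq_logMean_add d k, sectorPoint]
    congr 1
    have hdev : logDev d = γ * coneScale n β := by rw [hγd, div_mul_cancel₀ _ hc]
    rw [hdev, hα]
    field_simp
    ring
  rw [geoMean, matPow_eq hdiag, sectorCurve, hpt]
  have h1 : Mᵀ * M * (M⁻¹ * diagonal (fun k => d k ^ α) * M) =
      Mᵀ * diagonal (fun k => d k ^ α) * M := by
    simp only [Matrix.mul_assoc]
    rw [mul_nonsing_inv_cancel_left _ _ hM]
  have h2 : diagonal (fun k => etaFun β (Mᵀ * M) (Mᵀ * diagonal d * M) t * d k ^ α) =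
      etaFun β (Mᵀ * M) (Mᵀ * diagonal d * M) t • diagonal (fun k => d k ^ α) := by
    rw [← diagonal_smul]; rfl
  rw [h1, h2, Matrix.mul_smul, Matrix.smul_mul]

theorem exists_isPosDiagonalization {A : Matrix (Fin n) (Fin n) ℝ} (hA : A.PosDef) :
    ∃ (O : Matrix (Fin n) (Fin n) ℝ) (a : Fin n → ℝ), IsPosDiagonalization A O a := by
  obtain ⟨M, d, hM, hd, h1, h2⟩ := exists_simultaneous_diagonalization PosDef.one hA
  refine ⟨M, d, hM, hd, ?_⟩
  rw [h2, inv_eq_left_inv h1.symm]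

theorem IsPosDiagonalization.smul {C O : Matrix (Fin n) (Fin n) ℝ} {a : Fin n → ℝ} {r : ℝ}
    (h : IsPosDiagonalization C O a) (hr : 0 < r) :
    IsPosDiagonalization (r • C) O (fun k => r * a k) := by
  refine ⟨h.1, fun k => mul_pos hr (h.2.1 k), ?_⟩
  have : diagonal (fun k => r * a k) = r • diagonal a := by rw [← diagonal_smul]; rfl
  rw [this, h.2.2, Matrix.mul_smul, Matrix.smul_mul]

theorem matPow_smul {C O : Matrix (Fin n) (Fin n) ℝ} {a : Fin n → ℝ} {r : ℝ}
    (h : IsPosDiagonalization C O a) (hr : 0 < r) (q : ℝ) :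
    matPow (r • C) q = r ^ q • matPow C q := by
  rw [matPow_eq (h.smul hr), matPow_eq h]
  have : diagonal (fun k => (r * a k) ^ q) = r ^ q • diagonal (fun k => a k ^ q) := by
    rw [← diagonal_smul]
    congr 1
    ext k
    exact Real.mul_rpow hr.le (h.2.1 k).le
  rw [this, Matrix.mul_smul, Matrix.smul_mul]

theorem IsPosDiagonalization.matPow {C O : Matrix (Fin n) (Fin n) ℝ} {a : Fin n → ℝ}
    (h : IsPosDiagonalization C O a) (q : ℝ) :
    IsPosDiagonalization (matPow C q) O (fun k => a k ^ q) :=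
  ⟨h.1, fun k => Real.rpow_pos_of_pos (h.2.1 k) q, matPow_eq h q⟩

theorem matPow_matPow_inv {C O : Matrix (Fin n) (Fin n) ℝ} {a : Fin n → ℝ}
    (h : IsPosDiagonalization C O a) {q : ℝ} (hq : q ≠ 0) :
    PowerPotential.matPow (PowerPotential.matPow C q) (1 / q) = C := by
  have : (fun k => (a k ^ q) ^ (1 / q)) = a := by
    ext k
    rw [← Real.rpow_mul (h.2.1 k).le, mul_one_div_cancel hq, Real.rpow_one]
  rw [matPow_eq (h.matPow q), this, ← h.2.2]

/-- The power mean of two proportional positive-definite matrices. -/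
theorem powerMean_smul {A : Matrix (Fin n) (Fin n) ℝ} (hA : A.PosDef) {r p : ℝ} (hr : 0 < r)
    (hp : p ≠ 0) (ht : t ∈ Set.Icc (0 : ℝ) 1) :
    powerMean p A (r • A) t = (1 - t + t * r ^ p) ^ (1 / p) • A := by
  obtain ⟨O, a, h⟩ := exists_isPosDiagonalization hA
  rw [powerMean, matPow_smul h hr, smul_smul, ← add_smul,
    matPow_smul (h.matPow p) (segment_pos (Real.rpow_pos_of_pos hr p) ht), matPow_matPow_inv h hp]

theorem formula_of_gamma_eq_zero (hn : 1 ≤ n) (hβ0 : β ≠ 0) (hβ : β < 1 / n) (hM : IsUnit M.det)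
    (hd : ∀ k, 0 < d k)
    (hγ : gammaDist β (Mᵀ * M) (Mᵀ * diagonal d * M) = 0) (ht : t ∈ Set.Icc (0 : ℝ) 1) :
    Mᵀ * sectorCurve β (logDir d) (coneX β (logDir d) (diagonal d))
        (coneY β (logDir d) (diagonal d)) t * M =
      powerMean ((n : ℝ) * β / 2) (Mᵀ * M) (Mᵀ * diagonal d * M) t := by
  have hn0 : (n : ℝ) ≠ 0 := by positivity
  have hc := (coneScale_pos (n := n) hβ0 hβ).ne'
  rw [gammaDist_of_congruence hM hd, div_eq_zero_iff, or_iff_left hc] at hγ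
  have hang : coneAngle β (logDir d) (diagonal d) = 0 := by
    rw [coneAngle_logDir hn, hγ, zero_div]
  have hdk : d = fun _ => Real.exp (logMean d) := by
    ext k
    rw [← Real.exp_log (hd k), log_eq_logMean_add, hγ, zero_mul, add_zero]
  have hB : Mᵀ * diagonal d * M = Real.exp (logMean d) • (Mᵀ * M) := by
    have h1 : diagonal d = Real.exp (logMean d) • (1 : Matrix (Fin n) (Fin n) ℝ) := by
      rw [smul_one_eq_diagonal, ← hdk]
    rw [h1, Matrix.mul_smul, Matrix.smul_mul, Matrix.mul_one]
  have hA : (Mᵀ * M).PosDef := by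
    have := PosDef.conjTranspose_mul_self M
      (mulVec_injective_of_isUnit ((isUnit_iff_isUnit_det M).2 hM))
    simpa using this
  have hσ : coneRadius β (diagonal d) = Real.exp (logMean d) ^ ((n : ℝ) * β / 2) := by
    rw [← Real.exp_log (coneRadius_pos (β := β) (diagonal d)), log_coneRadius_diagonal hn,
      ← Real.exp_mul]
    congr 1
    ring
  have hpos : 0 < 1 - t + t * coneRadius β (diagonal d) := segment_pos (coneRadius_pos _) ht
  have hu : logDir d = 0 := by
    ext k
    simp [logDir, hγ]
  rw [hB, powerMean_smul hA (Real.exp_pos _) (by positivity) ht, ← hσ, sectorCurve, coneX, coneY,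
    hang, Real.cos_zero, Real.sin_zero, mul_one, mul_zero, mul_zero]
  have hpt : sectorPoint β (logDir d) (1 - t + t * coneRadius β (diagonal d)) 0 =
      fun _ => (1 - t + t * coneRadius β (diagonal d)) ^ (1 / ((n : ℝ) * β / 2)) := by
    ext k
    rw [sectorPoint, hu, Real.rpow_def_of_pos hpos, Pi.zero_apply, mul_zero, add_zero,
      zero_pow two_ne_zero, add_zero, Real.log_pow]
    congr 1
    push_cast
    field_simp
  rw [hpt, ← smul_one_eq_diagonal, Matrix.mul_smul, Matrix.smul_mul, Matrix.mul_one]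

end Formulas

/-! ### Existence and uniqueness of the geodesic -/

/-- For a pair in simultaneous diagonal form, the geodesic is the congruence image of the lifted
segment from the identity to the diagonal matrix. -/
theorem exists_unique_geodesic_of_congruence {n : ℕ} {β : ℝ} {M : Matrix (Fin n) (Fin n) ℝ}
    {d : Fin n → ℝ} (hn : 1 ≤ n) (hβ0 : β ≠ 0) (hβ : β < 1 / n) (hM : IsUnit M.det)
    (hd : ∀ k, 0 < d k) (hγ : gammaDist β (Mᵀ * M) (Mᵀ * diagonal d * M) < Real.pi / 2) :
    ∃ G : ℝ → Matrix (Fin n) (Fin n) ℝ,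
      IsGeodesic β (Mᵀ * M) (Mᵀ * diagonal d * M) G ∧
      (∀ P, IsGeodesic β (Mᵀ * M) (Mᵀ * diagonal d * M) P → Set.EqOn P G (Set.Icc 0 1)) ∧
      (∀ P, IsLengthMinimizing β (Mᵀ * M) (Mᵀ * diagonal d * M) P →
        ∃ s : ℝ → ℝ, ContinuousOn s (Set.Icc 0 1) ∧ MonotoneOn s (Set.Icc 0 1) ∧
          s 0 = 0 ∧ s 1 = 1 ∧ ∀ t ∈ Set.Icc (0 : ℝ) 1, P t = G (s t)) ∧
      (gammaDist β (Mᵀ * M) (Mᵀ * diagonal d * M) ≠ 0 → ∀ t ∈ Set.Icc (0 : ℝ) 1,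
        G t = etaFun β (Mᵀ * M) (Mᵀ * diagonal d * M) t •
          geoMean (Mᵀ * M) (Mᵀ * diagonal d * M)
            (alphaFun β (Mᵀ * M) (Mᵀ * diagonal d * M) t)) ∧
      (gammaDist β (Mᵀ * M) (Mᵀ * diagonal d * M) = 0 → ∀ t ∈ Set.Icc (0 : ℝ) 1,
        G t = powerMean ((n : ℝ) * β / 2) (Mᵀ * M) (Mᵀ * diagonal d * M) t) := by
  have hu := isDirection_logDir hn d
  have hc0 := coneScale_pos (n := n) hβ0 hβ
  have hang : |coneAngle β (logDir d) (diagonal d)| < Real.pi / 2 := by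
    rw [coneAngle_logDir hn, abs_of_nonneg (div_nonneg (logDev_nonneg d) hc0.le),
      ← gammaDist_of_congruence hM hd]
    exact hγ
  obtain ⟨x, hx⟩ : ∃ x, x = coneX β (logDir d) (diagonal d) := ⟨_, rfl⟩
  obtain ⟨y, hy⟩ : ∃ y, y = coneY β (logDir d) (diagonal d) := ⟨_, rfl⟩
  obtain ⟨ℓ, hℓ⟩ : ∃ ℓ, ℓ = √((x - 1) ^ 2 + y ^ 2) := ⟨_, rfl⟩
  have hx0 : 0 < x := hx ▸ mul_pos (coneRadius_pos _) (Real.cos_pos_of_mem_Ioo (abs_lt.1 hang))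
  have hy0 : logDir d = 0 → y = 0 := fun h => by
    rw [hy, coneY, coneAngle, h]
    simp
  have hsec : ∀ k, Real.log (d k) = (∑ j, Real.log (d j)) / n +
      (∑ j, logDir d j * Real.log (d j)) * logDir d k := fun k => by
    rw [sum_logDir_mul_log hn]
    exact log_eq_logMean_add d k
  have hmem := sectorCurve_mem hβ0 hβ hd hsec hang hx hy hx0
  have hspeed : ∀ t ∈ Set.Icc (0 : ℝ) 1,
      speed β (sectorCurve β (logDir d) x y) t = coneScale n β * ℓ := fun t ht => by
    rw [hℓ, sectorCurve_speed hn hβ0 hβ hu hx0 hy0 hmem ht]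
  have hlen : curveLength β (sectorCurve β (logDir d) x y) = coneScale n β * ℓ := by
    rw [curveLength, intervalIntegral.integral_congr (g := fun _ => coneScale n β * ℓ)]
    · simp
    · intro t ht
      rw [Set.uIcc_of_le zero_le_one] at ht
      exact hspeed t ht
  -- Congruence by `M` and by its inverse.
  have hMt : IsUnit Mᵀ.det := by rwa [det_transpose]
  have hMi : IsUnit M⁻¹.det := isUnit_nonsing_inv_det _ hM
  have hback : ∀ X : Matrix (Fin n) (Fin n) ℝ, Mᵀ * ((M⁻¹)ᵀ * X * M⁻¹) * M = X := fun X => by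
    rw [transpose_nonsing_inv]
    simp only [Matrix.mul_assoc]
    rw [nonsing_inv_mul _ hM, mul_nonsing_inv_cancel_left _ _ hMt, Matrix.mul_one]
  have hpull : ∀ X : Matrix (Fin n) (Fin n) ℝ, (M⁻¹)ᵀ * (Mᵀ * X * M) * M⁻¹ = X := fun X => by
    rw [transpose_nonsing_inv]
    simp only [Matrix.mul_assoc]
    rw [mul_nonsing_inv _ hM, nonsing_inv_mul_cancel_left _ _ hMt, Matrix.mul_one]
  obtain ⟨μ, hμ⟩ : ∃ μ, μ = √((M.det ^ 2) ^ β) := ⟨_, rfl⟩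
  have hμ0 : 0 < μ := by
    have := hM.ne_zero
    rw [hμ]
    positivity
  obtain ⟨G, hG⟩ : ∃ G : ℝ → Matrix (Fin n) (Fin n) ℝ,
    G = fun t => Mᵀ * sectorCurve β (logDir d) x y t * M := ⟨_, rfl⟩
  have hGmem : G ∈ curvesJoining (Mᵀ * M) (Mᵀ * diagonal d * M) := by
    have := curvesJoining_congruence hM hmem
    rwa [Matrix.mul_one, ← hG] at this
  have hGlen : curveLength β G = μ * (coneScale n β * ℓ) := by
    rw [hG, curveLength_congruence hM hmem, hlen, hμ]
  have hred : ∀ P ∈ curvesJoining (Mᵀ * M) (Mᵀ * diagonal d * M),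
      ∃ Q ∈ curvesJoining 1 (diagonal d), (fun t => Mᵀ * Q t * M) = P := by
    intro P hP
    have h := curvesJoining_congruence hMi hP
    have h1 := hpull 1
    rw [Matrix.mul_one] at h1
    rw [hpull, h1] at h
    exact ⟨_, h, funext fun t => hback (P t)⟩
  have hGmin : ∀ P ∈ curvesJoining (Mᵀ * M) (Mᵀ * diagonal d * M),
      curveLength β G ≤ curveLength β P := by
    intro P hP
    obtain ⟨Q, hQ, rfl⟩ := hred P hP
    rw [hGlen, curveLength_congruence hM hQ, ← hμ]
    exact mul_le_mul_of_nonneg_left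
      (length_lower_bound_and_rigidity hn hβ0 hβ hu hQ hx hy hx0 hℓ).1 hμ0.le
  have hrigid : ∀ P, IsLengthMinimizing β (Mᵀ * M) (Mᵀ * diagonal d * M) P →
      ∃ s : ℝ → ℝ, ContinuousOn s (Set.Icc 0 1) ∧ MonotoneOn s (Set.Icc 0 1) ∧
        s 0 = 0 ∧ s 1 = 1 ∧ (∀ t ∈ Set.Icc (0 : ℝ) 1, P t = G (s t)) ∧
        ((∃ v : ℝ, ∀ t ∈ Set.Icc (0 : ℝ) 1, speed β P t = v) →
          ∀ t ∈ Set.Icc (0 : ℝ) 1, s t = t) := by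
    rintro P ⟨hP, hPmin⟩
    obtain ⟨Q, hQ, rfl⟩ := hred P hP
    have hQlen : curveLength β Q = coneScale n β * ℓ := by
      have h := le_antisymm (hPmin G hGmem) (hGmin _ hP)
      rw [hGlen, curveLength_congruence hM hQ, ← hμ] at h
      exact mul_left_cancel₀ hμ0.ne' h
    obtain ⟨s, hs, hsm, hs0, hs1, hQs, hconst⟩ :=
      (length_lower_bound_and_rigidity hn hβ0 hβ hu hQ hx hy hx0 hℓ).2 hQlen
    refine ⟨s, hs, hsm, hs0, hs1, fun t ht => by simp only [hG, hQs t ht], ?_⟩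
    rintro ⟨v, hv⟩
    refine hconst ⟨v / μ, fun t ht => ?_⟩
    rw [eq_div_iff hμ0.ne', ← hv t ht, speed_congruence hM hQ ht, ← hμ, mul_comm]
  refine ⟨G, ⟨⟨hGmem, hGmin⟩, μ * (coneScale n β * ℓ), fun t ht => ?_⟩, ?_, ?_, ?_, ?_⟩
  · rw [hG, speed_congruence hM hmem ht, hspeed t ht, hμ]
  · rintro P ⟨hP, hv⟩ t ht
    obtain ⟨s, -, -, -, -, hPs, hs⟩ := hrigid P hP
    rw [hPs t ht, hs hv t ht]
  · intro P hP
    obtain ⟨s, hs, hsm, hs0, hs1, hPs, -⟩ := hrigid P hP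
    exact ⟨s, hs, hsm, hs0, hs1, hPs⟩
  · intro h t ht
    rw [hG, hx, hy]
    exact formula_of_gamma_ne_zero hn hβ0 hM hd (hx ▸ hx0) h ht
  · intro h t ht
    rw [hG, hx, hy]
    exact formula_of_gamma_eq_zero hn hβ0 hβ hM hd h ht

end PowerPotential

theorem mainTheorem2 (n : ℕ) (hn : 1 ≤ n) (β : ℝ)
    (hβ : β ∈ Set.Iio (0 : ℝ) ∪ Set.Ioo (0 : ℝ) (1 / (n : ℝ)))
    (A B : Matrix (Fin n) (Fin n) ℝ) (hA : A.PosDef) (hB : B.PosDef)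
    (hγ : PowerPotential.gammaDist β A B < Real.pi / 2) :
    ∃ G : ℝ → Matrix (Fin n) (Fin n) ℝ,
      PowerPotential.IsGeodesic β A B G ∧
      (∀ P : ℝ → Matrix (Fin n) (Fin n) ℝ, PowerPotential.IsGeodesic β A B P →
        Set.EqOn P G (Set.Icc 0 1)) ∧
      (∀ P : ℝ → Matrix (Fin n) (Fin n) ℝ, PowerPotential.IsLengthMinimizing β A B P →
        ∃ s : ℝ → ℝ, ContinuousOn s (Set.Icc 0 1) ∧ MonotoneOn s (Set.Icc 0 1) ∧
          s 0 = 0 ∧ s 1 = 1 ∧ ∀ t ∈ Set.Icc (0 : ℝ) 1, P t = G (s t)) ∧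
      (PowerPotential.gammaDist β A B ≠ 0 → ∀ t ∈ Set.Icc (0 : ℝ) 1,
        G t = PowerPotential.etaFun β A B t •
          PowerPotential.geoMean A B (PowerPotential.alphaFun β A B t)) ∧
      (PowerPotential.gammaDist β A B = 0 → ∀ t ∈ Set.Icc (0 : ℝ) 1,
        G t = PowerPotential.powerMean ((n : ℝ) * β / 2) A B t) := by
  have hβ0 : β ≠ 0 := by
    rcases hβ with h | h
    · exact (Set.mem_Iio.1 h).ne
    · exact h.1.ne'
  have hβ1 : β < 1 / n := by
    rcases hβ with h | h
    · exact (Set.mem_Iio.1 h).trans_le (by positivity)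
    · exact h.2
  obtain ⟨M, d, hM, hd, rfl, rfl⟩ := PowerPotential.exists_simultaneous_diagonalization hA hB
  exact PowerPotential.exists_unique_geodesic_of_congruence hn hβ0 hβ1 hM hd hγ
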